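/- Let $d\ge 0$ and let $G_1=(V_1,E_1),\dots,G_d=(V_d,E_d)$ be finite simple connected graphs, each with at least one edge, with a total order fixed on each $V_i$. Put $\mathscr G=G_1\times\dots\times G_d$, with vertex set $\mathscr G_0=V_1\times\dots\times V_d$ ordered coordinatewise. A $1$-simplex of $\mathscr G$ is a pair $\mathbf u\le\mathbf v$ in $\mathscr G_0$ such that for each $i$ either $u_i=v_i$ or $\{u_i,v_i\}\in E_i$; for such a pair let $I(\mathbf u,\mathbf v)=\{i : u_i<v_i\}$. A $k$-simplex is a sequence $\mathbf v_0\le\dots\le\mathbf v_k$ whose consecutive pairs are $1$-simplices and for which the sets $I(\mathbf v_j,\mathbf v_{j+1})$ are pairwise disjoint. The Chow ring $\mathrm{Chow}_{GS}(\mathscr G)$ is the quotient of the polynomial ring $\mathbb Z[C_{\mathbf v} : \mathbf v\in\mathscr G_0]$, graded by $\deg C_{\mathbf v}=1$, by the ideal generated by 1. $C_{\mathbf v_1}\cdots C_{\mathbf v_k}$ for $k\ge 1$ and vertices $\mathbf v_1,\dots,\mathbf v_k$ that do not form a simplex (in any order); 2. $C_{\mathbf u}\sum_{\mathbf v\in\mathscr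 G_0}C_{\mathbf v}$ for $\mathbf u\in\mathscr G_0$; 3. $C_{\mathbf u}C_{\mathbf w}\sum_{\mathbf v\in\mathscr G_0,\,v_i=u_i}C_{\mathbf v}$ for $\mathbf u,\mathbf w\in\mathscr G_0$ and $i$ with $u_i\ne w_i$. The same definition applies to products of subgraphs of the $G_i$ with the induced orders, and an inclusion $\mathscr H'\subseteq\mathscr H$ of such products induces the restriction map $\mathrm{Chow}_{GS}(\mathscr H)\to\mathrm{Chow}_{GS}(\mathscr H')$, which sends $C_{\mathbf v}$ to $C_{\mathbf v}$ if $\mathbf v$ is a vertex of $\mathscr H'$ and to $0$ otherwise. For $\mathbf e\in\mathscr E=E_1\times\dots\times E_d$ let $\square_{\mathbf e}=e_1\times\dots\times e_d$. For $1\le i\le d$ let $\mathscr E_i=E_1\times\dots\times E_{i-1}\times E(L(G_i))\times E_{i+1}\times\dots\times E_d$, where $L(G_i)$ is the line graph of $G_i$ (its vertices are the edges of $G_i$, and its edges are the pairs of distinct edges of $G_i$ that share a vertex). Fix a total order on each $E_i$. An element $\mathbf x\in\mathscr E_i$, with $i$-th entry $\{e_{i,1},e_{i,2}\}$, $e_{i,1}<e_{i,2}$,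 gives two hypercubes $\square_{\mathbf e_1},\square_{\mathbf e_2}$ (with $i$-th factor $e_{i,1}$, resp. $e_{i,2}$, and the same other factors), which share the facet $\square_{\mathbf x}=\square_{\mathbf e_1}\cap\square_{\mathbf e_2}$. Let $$j:\prod_{\mathbf e\in\mathscr E}\mathrm{Chow}_{GS}(\square_{\mathbf e})\to\prod_{i=1}^d\prod_{\mathbf x\in\mathscr E_i}\mathrm{Chow}_{GS}(\square_{\mathbf x}),\qquad j(\alpha)_{\mathbf x}=\alpha_{\mathbf e_1}|_{\square_{\mathbf x}}-\alpha_{\mathbf e_2}|_{\square_{\mathbf x}}.$$ **Theorem (localization).** The product of the restriction maps $$\mathrm{Chow}_{GS}(\mathscr G)\to\prod_{\mathbf e\in\mathscr E}\mathrm{Chow}_{GS}(\square_{\mathbf e})$$ is an injective map of graded rings (an element of $\mathrm{Chow}_{GS}(\mathscr G)$ is homogeneous of degree $k$ if and only if all its restrictions are), and its image is the kernel of $j$. Moreover, $\mathrm{Chow}_{GS}(\mathscr G)$ is the inverse limit of the Chow rings of the cubes of $\mathscr G$ (of all dimensions, that is, the products of vertices and edges of the $G_i$) for the maps induced by the inclusions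 of cubes: the restriction maps identify it with the ring of the families $(x_c)_c$, $x_c\in\mathrm{Chow}_{GS}(c)$, such that $x_{c'}|_c=x_c$ whenever $c\subseteq c'$. -/

import Mathlib

open MvPolynomial

universe u v

namespace ChowGS

section Simplices

variable {d : ℕ} {V : Fin d → Type u} [∀ i, LinearOrder (V i)]

/-- Pairs `u ≤ v` of vertices of `∏ Gᵢ` such that, for each `i`, `uᵢ = vᵢ` or `{uᵢ, vᵢ}` is an
edge of `Gᵢ`: the 1-simplices of the product. -/
def IsOneSimplex (G : ∀ i, SimpleGraph (V i)) (u v : ∀ i, V i) : Prop :=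
  u ≤ v ∧ ∀ i, u i = v i ∨ (G i).Adj (u i) (v i)

/-- The set `I(u, v)` of the indices `i` with `uᵢ < vᵢ`. -/
def incrSet (u v : ∀ i, V i) : Set (Fin d) := {i | u i < v i}

/-- The `k`-simplices (possibly degenerate): sequences `v₀ ≤ ⋯ ≤ vₖ` whose consecutive pairs are
1-simplices and for which the sets `I(vⱼ, vⱼ₊₁)` are pairwise disjoint. -/
def IsSimplex (G : ∀ i, SimpleGraph (V i)) {k : ℕ} (σ : Fin (k + 1) → ∀ i, V i) : Prop :=
  (∀ j : Fin k, IsOneSimplex G (σ j.castSucc) (σ j.succ)) ∧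
  ∀ j j' : Fin k, j ≠ j' →
    Disjoint (incrSet (σ j.castSucc) (σ j.succ)) (incrSet (σ j'.castSucc) (σ j'.succ))

/-- The vertices `v₀, …, vₖ` form a simplex: in a suitable order they are a `k`-simplex. -/
def FormsSimplex (G : ∀ i, SimpleGraph (V i)) {k : ℕ} (v : Fin (k + 1) → ∀ i, V i) : Prop :=
  ∃ π : Equiv.Perm (Fin (k + 1)), IsSimplex G (v ∘ π)

end Simplices

section Chow

variable {d : ℕ} {V : Fin d → Type u} [∀ i, LinearOrder (V i)] [∀ i, Fintype (V i)]

/-- Generators of the ideal of elements rationally equivalent to zero in `ℤ[C_v]`, where `X v` is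
the variable `C_v`. -/
inductive IsRelation (G : ∀ i, SimpleGraph (V i)) : MvPolynomial (∀ i, V i) ℤ → Prop
  | r1 (k : ℕ) (v : Fin (k + 1) → ∀ i, V i) (hv : ¬ FormsSimplex G v) :
      IsRelation G (∏ j, X (v j))
  | r2 (u : ∀ i, V i) : IsRelation G (X u * ∑ v : ∀ i, V i, X v)
  | r3 (u w : ∀ i, V i) (i : Fin d) (h : u i ≠ w i) :
      IsRelation G (X u * X w * ∑ v : ∀ i, V i with v i = u i, X v)

/-- The ideal of elements rationally equivalent to zero. -/
noncomputable def Irat (G : ∀ i, SimpleGraph (V i)) : Ideal (MvPolynomial (∀ i, V i) ℤ) :=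
  Ideal.span {p | IsRelation G p}

/-- The combinatorial Chow ring of the product of the graphs `G i`. -/
def Chow (G : ∀ i, SimpleGraph (V i)) : Type u :=
  MvPolynomial (∀ i, V i) ℤ ⧸ Irat G

noncomputable instance (G : ∀ i, SimpleGraph (V i)) : CommRing (Chow G) :=
  inferInstanceAs (CommRing (MvPolynomial (∀ i, V i) ℤ ⧸ Irat G))

/-- The class of a polynomial in the Chow ring. -/
noncomputable def chowMk (G : ∀ i, SimpleGraph (V i)) :
    MvPolynomial (∀ i, V i) ℤ →+* Chow G :=
  Ideal.Quotient.mk (Irat G)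

/-- The graded piece of degree `k` of the Chow ring: the classes of the homogeneous polynomials of
degree `k`, all variables having degree one. -/
noncomputable def chowDeg (G : ∀ i, SimpleGraph (V i)) (k : ℕ) : AddSubgroup (Chow G) :=
  (homogeneousSubmodule (∀ i, V i) ℤ k).toAddSubgroup.map (chowMk G).toAddMonoidHom

end Chow

section Functoriality

variable {d : ℕ} {V : Fin d → Type u} [∀ i, LinearOrder (V i)]
  {W : Fin d → Type v} [∀ i, LinearOrder (W i)]

/-- A family of order preserving homomorphisms of graphs `Hᵢ → Gᵢ`; a homomorphism may contract
edges. -/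
structure IsOrderedHom (H : ∀ i, SimpleGraph (W i)) (G : ∀ i, SimpleGraph (V i))
    (f : ∀ i, W i → V i) : Prop where
  mono : ∀ i, Monotone (f i)
  hom : ∀ i a b, (H i).Adj a b → f i a = f i b ∨ (G i).Adj (f i a) (f i b)

/-- The map `∏ Wᵢ → ∏ Vᵢ` induced on vertices. -/
def vmap (f : ∀ i, W i → V i) (u : ∀ i, W i) : ∀ i, V i := fun i => f i (u i)

theorem FormsSimplex.map {H : ∀ i, SimpleGraph (W i)} {G : ∀ i, SimpleGraph (V i)}
    {f : ∀ i, W i → V i} (hf : IsOrderedHom H G f) {k : ℕ} {p : Fin (k + 1) → ∀ i, W i}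
    (hp : FormsSimplex H p) : FormsSimplex G fun j => vmap f (p j) := by
  obtain ⟨π, h1, h2⟩ := hp
  have key : ∀ a b : ∀ i, W i, incrSet (vmap f a) (vmap f b) ⊆ incrSet a b := by
    intro a b i hi
    by_contra hc
    exact absurd (hf.mono i (not_lt.1 hc)) (not_le.2 hi)
  refine ⟨π, fun j => ⟨fun i => hf.mono i ((h1 j).1 i), fun i => ?_⟩,
    fun j j' hj => (h2 j j' hj).mono (key _ _) (key _ _)⟩
  rcases (h1 j).2 i with h | h
  · exact Or.inl (congrArg (f i) h)
  · exact hf.hom i _ _ h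

theorem not_formsSimplex_of_three (H : ∀ i, SimpleGraph (W i)) (a b c : ∀ i, W i) (i : Fin d)
    (hab : a i ≠ b i) (hac : a i ≠ c i) (hbc : b i ≠ c i) : ¬ FormsSimplex H ![a, b, c] := by
  rintro ⟨π, h1, h2⟩
  have inj : ∀ s t : Fin 3, (![a, b, c] s) i = (![a, b, c] t) i → s = t := by
    intro s t h
    fin_cases s <;> fin_cases t <;>
      first
        | rfl
        | exact absurd h hab
        | exact absurd h hac
        | exact absurd h hbc
        | exact absurd h.symm hab
        | exact absurd h.symm hac
        | exact absurd h.symm hbc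
  have lt : ∀ j : Fin 2, i ∈ incrSet ((![a, b, c] ∘ π) j.castSucc) ((![a, b, c] ∘ π) j.succ) := by
    intro j
    refine lt_of_le_of_ne ((h1 j).1 i) fun h => ?_
    have := π.injective (inj _ _ h)
    exact absurd this (Fin.castSucc_lt_succ).ne
  exact Set.disjoint_left.1 (h2 0 1 (by decide)) (lt 0) (lt 1)

variable [∀ i, Fintype (V i)] [∀ i, Fintype (W i)]

/-- The pull-back of polynomials, `C_v ↦ ∑_{f(u) = v} C_u`. -/
noncomputable def polyPull (f : ∀ i, W i → V i) :
    MvPolynomial (∀ i, V i) ℤ →ₐ[ℤ] MvPolynomial (∀ i, W i) ℤ :=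
  aeval fun v => ∑ u : ∀ i, W i with vmap f u = v, X u

theorem polyPull_sum (f : ∀ i, W i → V i) (P : (∀ i, V i) → Prop) [DecidablePred P] :
    polyPull f (∑ v : ∀ i, V i with P v, X v) = ∑ u : ∀ i, W i with P (vmap f u), X u := by
  simp only [polyPull, map_sum, aeval_X]
  rw [← Finset.sum_fiberwise_of_maps_to (s := Finset.univ.filter fun u => P (vmap f u))
    (t := Finset.univ.filter P) (g := vmap f) (by simp)]
  refine Finset.sum_congr rfl fun v hv => Finset.sum_congr ?_ fun _ _ => rfl
  ext u
  simp only [Finset.mem_filter, Finset.mem_univ, true_and] at hv ⊢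
  exact ⟨fun h => ⟨h ▸ hv, h⟩, fun h => h.2⟩

theorem Irat_le_comap {H : ∀ i, SimpleGraph (W i)} {G : ∀ i, SimpleGraph (V i)}
    {f : ∀ i, W i → V i} (hf : IsOrderedHom H G f) :
    Irat G ≤ (Irat H).comap (polyPull f).toRingHom := by
  refine Ideal.span_le.2 ?_
  rintro _ (⟨k, v, hv⟩ | ⟨u⟩ | ⟨u, w, i, h⟩)
  · change polyPull f (∏ j, X (v j)) ∈ Irat H
    simp only [polyPull, map_prod, aeval_X]
    rw [Finset.prod_univ_sum]
    refine Ideal.sum_mem _ fun p hp => Ideal.subset_span (.r1 k p fun hs => hv ?_)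
    have : (fun j => vmap f (p j)) = v := by
      funext j
      simpa using Fintype.mem_piFinset.1 hp j
    exact this ▸ hs.map hf
  · change polyPull f (X u * ∑ v : ∀ i, V i, X v) ∈ Irat H
    have := polyPull_sum f fun _ => True
    simp only [Finset.filter_true] at this
    rw [map_mul, this]
    simp only [polyPull, aeval_X, Finset.sum_mul]
    exact Ideal.sum_mem _ fun a _ => Ideal.subset_span (.r2 a)
  · change polyPull f (X u * X w * ∑ v : ∀ i, V i with v i = u i, X v) ∈ Irat H
    rw [map_mul, map_mul, polyPull_sum f fun v => v i = u i]
    simp only [polyPull, aeval_X]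
    rw [Finset.sum_mul_sum]
    simp only [Finset.sum_mul _ _ (∑ v : ∀ i, W i with _, X v)]
    refine Ideal.sum_mem _ fun a ha => Ideal.sum_mem _ fun b hb => ?_
    simp only [Finset.mem_filter, Finset.mem_univ, true_and] at ha hb
    have hab : a i ≠ b i := by
      intro e
      apply h
      rw [← ha, ← hb]
      simp [vmap, e]
    rw [← Finset.sum_filter_add_sum_filter_not _ (fun y : ∀ i, W i => y i = a i), mul_add]
    refine Ideal.add_mem _ ?_ ?_
    · have : (Finset.univ.filter fun y : ∀ i, W i => vmap f y i = u i).filter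
          (fun y => y i = a i) = Finset.univ.filter fun y => y i = a i := by
        ext y
        simp only [Finset.mem_filter, Finset.mem_univ, true_and, and_iff_right_iff_imp]
        intro e
        rw [← ha]
        simp [vmap, e]
      rw [this]
      exact Ideal.subset_span (.r3 a b i hab)
    · rw [Finset.mul_sum]
      refine Ideal.sum_mem _ fun y hy => ?_
      simp only [Finset.mem_filter, Finset.mem_univ, true_and] at hy
      have hby : b i ≠ y i := by
        intro e
        apply h
        rw [← hy.1, ← hb]
        simp [vmap, e]
      have := Ideal.subset_span (s := {p | IsRelation H p})
        (.r1 2 ![a, b, y] (not_formsSimplex_of_three H a b y i hab (Ne.symm hy.2) hby))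
      simpa [Fin.prod_univ_three, Irat] using this

/-- The map of Chow rings induced by a family of order preserving homomorphisms of graphs. -/
noncomputable def chowPull {H : ∀ i, SimpleGraph (W i)} {G : ∀ i, SimpleGraph (V i)}
    {f : ∀ i, W i → V i} (hf : IsOrderedHom H G f) : Chow G →+* Chow H :=
  Ideal.quotientMap (Irat H) (polyPull f).toRingHom (Irat_le_comap hf)

end Functoriality

section Cubes

variable {d : ℕ} {V : Fin d → Type u} [∀ i, LinearOrder (V i)]

/-- The subgraphs of the `Gᵢ` induced on the vertex sets `Sᵢ`. -/
abbrev sub (G : ∀ i, SimpleGraph (V i)) (S : ∀ i, Finset (V i)) : ∀ i, SimpleGraph (S i) :=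
  fun i => (G i).comap Subtype.val

/-- The restriction from `∏ Gᵢ` to `∏ Gᵢ[Sᵢ]`. -/
noncomputable def restr [∀ i, Fintype (V i)] (G : ∀ i, SimpleGraph (V i)) (S : ∀ i, Finset (V i)) :
    Chow G →+* Chow (sub G S) :=
  chowPull (f := fun _ => Subtype.val)
    ⟨fun _ _ _ h => h, fun _ _ _ h => Or.inr h⟩

/-- The restriction from `∏ Gᵢ[Tᵢ]` to `∏ Gᵢ[Sᵢ]`, for `Sᵢ ⊆ Tᵢ`. -/
noncomputable def restrOfLE (G : ∀ i, SimpleGraph (V i)) {S T : ∀ i, Finset (V i)}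
    (h : ∀ i, S i ⊆ T i) : Chow (sub G T) →+* Chow (sub G S) :=
  chowPull (f := fun i x => ⟨x.1, h i x.2⟩)
    ⟨fun _ _ _ h => h, fun _ _ _ h => Or.inr h⟩

/-- The vertex sets of the factors of the hypercube `□_e = e₁ × ⋯ × e_d`. An edge, as a subgraph,
is the subgraph induced on its two ends. -/
def edgeCube {G : ∀ i, SimpleGraph (V i)} (e : ∀ i, (G i).edgeSet) : ∀ i, Finset (V i) :=
  fun i => (e i : Sym2 (V i)).toFinset

/-- The Chow ring of the hypercube `□_e`. -/
abbrev ChowCube (G : ∀ i, SimpleGraph (V i)) (e : ∀ i, (G i).edgeSet) : Type u :=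
  Chow (sub G (edgeCube e))

/-- The product of the restrictions to all the hypercubes `□_e`. -/
noncomputable def toHypercubes [∀ i, Fintype (V i)] (G : ∀ i, SimpleGraph (V i)) :
    Chow G →+* ∀ e : ∀ i, (G i).edgeSet, ChowCube G e :=
  RingHom.pi fun e => restr G (edgeCube e)

/-- The elements of `E₁ × ⋯ × E(L(Gᵢ)) × ⋯ × E_d`, where `L(Gᵢ)` is the line graph. Such an
element is recorded as the two tuples of edges that it gives: they agree outside the index `i`, and
at the index `i` they have the two ends of the given edge of `L(Gᵢ)`, the smaller one first for the
chosen total order on `Eᵢ`. -/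
structure SharedFacet (G : ∀ i, SimpleGraph (V i)) (ordE : ∀ i, LinearOrder (G i).edgeSet)
    (i : Fin d) where
  fst : ∀ j, (G j).edgeSet
  snd : ∀ j, (G j).edgeSet
  agree : ∀ j, j ≠ i → fst j = snd j
  adj : (G i).lineGraph.Adj (fst i) (snd i)
  lt : (ordE i).lt (fst i) (snd i)

/-- The vertex sets of the factors of the facet `□_x = □_{e₁} ∩ □_{e₂}`. -/
def SharedFacet.cube {G : ∀ i, SimpleGraph (V i)} {ordE : ∀ i, LinearOrder (G i).edgeSet}
    {i : Fin d} (x : SharedFacet G ordE i) : ∀ j, Finset (V j) :=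
  fun j => edgeCube x.fst j ∩ edgeCube x.snd j

theorem SharedFacet.cube_subset_fst {G : ∀ i, SimpleGraph (V i)}
    {ordE : ∀ i, LinearOrder (G i).edgeSet} {i : Fin d} (x : SharedFacet G ordE i) (j : Fin d) :
    x.cube j ⊆ edgeCube x.fst j := Finset.inter_subset_left

theorem SharedFacet.cube_subset_snd {G : ∀ i, SimpleGraph (V i)}
    {ordE : ∀ i, LinearOrder (G i).edgeSet} {i : Fin d} (x : SharedFacet G ordE i) (j : Fin d) :
    x.cube j ⊆ edgeCube x.snd j := Finset.inter_subset_right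

/-- The map `j`: differences of the restrictions to the shared facets. -/
noncomputable def facetDiff (G : ∀ i, SimpleGraph (V i))
    (ordE : ∀ i, LinearOrder (G i).edgeSet) :
    (∀ e : ∀ i, (G i).edgeSet, ChowCube G e) →+
      ∀ (i : Fin d) (x : SharedFacet G ordE i), Chow (sub G x.cube) where
  toFun α := fun _ x =>
    restrOfLE G x.cube_subset_fst (α x.fst) - restrOfLE G x.cube_subset_snd (α x.snd)
  map_zero' := by
    funext i x
    simp
  map_add' α β := by
    funext i x
    simp only [Pi.add_apply, map_add]
    abel

/-- The cubes of all dimensions of `∏ Gᵢ`: products of vertices and edges of the `Gᵢ`. -/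
structure Cube (G : ∀ i, SimpleGraph (V i)) where
  verts : ∀ i, Finset (V i)
  isCube : ∀ i, (∃ v, verts i = {v}) ∨ ∃ e ∈ (G i).edgeSet, verts i = e.toFinset

/-- The restrictions to the cubes of all dimensions. -/
noncomputable def toCubes [∀ i, Fintype (V i)] (G : ∀ i, SimpleGraph (V i)) :
    Chow G →+* ∀ c : Cube G, Chow (sub G c.verts) :=
  RingHom.pi fun c => restr G c.verts

/-- The inverse limit of the Chow rings of the cubes of `∏ Gᵢ`, for the maps induced by the
inclusions of cubes. -/
def cubeLimit (G : ∀ i, SimpleGraph (V i)) : Subring (∀ c : Cube G, Chow (sub G c.verts)) where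
  carrier := {x | ∀ (c c' : Cube G) (h : ∀ i, c.verts i ⊆ c'.verts i),
    restrOfLE G h (x c') = x c}
  mul_mem' hx hy c c' h := by simp [hx c c' h, hy c c' h]
  one_mem' c c' h := by simp
  add_mem' hx hy c c' h := by simp [hx c c' h, hy c c' h]
  zero_mem' c c' h := by simp
  neg_mem' hx c c' h := by simp [hx c c' h]

end Cubes

end ChowGS

/-! The additive group of the Chow ring has an explicit finite ℤ-basis, compatible with restriction.
Call a face (the vertex set of a simplex) basic if each of its interior vertices is a descent; the
basis consists of the monomials of the basic faces. Being basic depends only on the vertices of the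
face, so restriction to a product of induced subgraphs keeps the basis monomials supported there and
kills the others (`coef_chowPull`). An element thus becomes an integer function on basic faces, a
restriction becomes a restriction of functions, and homogeneity becomes a condition on supports.
Each face lies in some hypercube, so a function is determined by its restrictions. Conversely,
functions on the hypercubes that agree on shared facets glue: two hypercubes containing a nonempty
face are joined by changing one edge at a time, each time through a shared vertex. Only the empty
face, the coefficient of 1, requires walking through the connected graphs.

Spanning is a straightening argument (`Straightens.mon_mem`). Relations 2 and 3 rewrite a repeated
variable by monomials with larger support, and a non-descent by faces with more inversions; both
quantities are bounded.

Independence comes from a deformation. Relations 2 and 3 are perturbed to $C_u(\sum C_v-1)$ and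
$C_uC_w(\sum_{v_i=u_i}C_v-c)$, where $c$ depends only on $i$ and on which end of its edge $u_i$ is.
Their common zeros include the barycentric coordinates of a generic integral point along any maximal
path of a cube. Evaluation of the basic monomials at suitable such points is triangular
(`linearIndependent_evalPoints`). A homogeneous element of degree $k$ of the relation ideal
evaluates into the span of basic monomials of degree below $k$, so independence of the values passes
to the Chow ring (`linearIndependent_basicClass`). -/

namespace ChowGS

/-! ### Simplices as vertex sets -/

section Faces

variable {d : ℕ} {V : Fin d → Type u} [∀ i, LinearOrder (V i)]

/-- The finite sets of vertices that are the vertex sets of simplices: chains on which each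
coordinate is constant or takes the two ends of an edge as values. -/
structure IsFace (G : ∀ i, SimpleGraph (V i)) (S : Finset (∀ i, V i)) : Prop where
  total : ∀ u ∈ S, ∀ v ∈ S, u ≤ v ∨ v ≤ u
  adj : ∀ u ∈ S, ∀ v ∈ S, ∀ i, u i = v i ∨ (G i).Adj (u i) (v i)
  not_three : ∀ u ∈ S, ∀ v ∈ S, ∀ w ∈ S, ∀ i, u i < v i → v i < w i → False

variable {G : ∀ i, SimpleGraph (V i)} {S : Finset (∀ i, V i)}

theorem IsFace.subset {T : Finset (∀ i, V i)} (hS : IsFace G S) (h : T ⊆ S) : IsFace G T :=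
  ⟨fun u hu v hv => hS.total u (h hu) v (h hv), fun u hu v hv => hS.adj u (h hu) v (h hv),
    fun u hu v hv w hw => hS.not_three u (h hu) v (h hv) w (h hw)⟩

theorem IsFace.le_of_lt_apply (hS : IsFace G S) {u v : ∀ i, V i} (hu : u ∈ S) (hv : v ∈ S)
    {i : Fin d} (h : u i < v i) : u ≤ v :=
  (hS.total u hu v hv).resolve_right fun h' => absurd (h' i) (not_le.2 h)

theorem IsFace.eq_of_lt_of_ne (hS : IsFace G S) {u v w : ∀ i, V i} (hu : u ∈ S) (hv : v ∈ S)
    (hw : w ∈ S) {i : Fin d} (h : u i < v i) (hne : w i ≠ u i) : w i = v i := by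
  rcases lt_trichotomy (w i) (v i) with h1 | h1 | h1
  · rcases lt_or_gt_of_ne hne with h2 | h2
    · exact (hS.not_three w hw u hu v hv i h2 h).elim
    · exact (hS.not_three u hu w hw v hv i h2 h1).elim
  · exact h1
  · exact (hS.not_three u hu v hv w hw i h h1).elim

theorem IsFace.eq_of_le_of_lt (hS : IsFace G S) {u v w : ∀ i, V i} (hu : u ∈ S) (hv : v ∈ S)
    (hw : w ∈ S) {i : Fin d} (hwu : w i ≤ u i) (h : u i < v i) : w i = u i :=
  hwu.eq_or_lt.resolve_right fun h' => hS.not_three w hw u hu v hv i h' h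

theorem IsFace.eq_of_lt_of_le (hS : IsFace G S) {u v w : ∀ i, V i} (hu : u ∈ S) (hv : v ∈ S)
    (hw : w ∈ S) {i : Fin d} (h : u i < v i) (hwv : v i ≤ w i) : w i = v i :=
  (hwv.eq_or_lt.resolve_right fun h' => hS.not_three u hu v hv w hw i h h').symm

theorem exists_lt_apply {u v : ∀ i, V i} (h : u < v) : ∃ i, u i < v i := by
  obtain ⟨_, i, hi⟩ := Pi.lt_def.1 h
  exact ⟨i, hi⟩

theorem exists_rise {k : ℕ} {σ : Fin (k + 1) → ∀ i, V i} (hσ : Monotone σ) (i : Fin d)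
    (p q : Fin (k + 1)) (h : σ p i < σ q i) :
    ∃ j : Fin k, p ≤ j.castSucc ∧ j.succ ≤ q ∧ σ j.castSucc i < σ j.succ i := by
  induction q using Fin.induction with
  | zero => exact absurd (hσ (Fin.zero_le p) i) (not_le.2 h)
  | succ j ih =>
    by_cases h1 : σ p i < σ j.castSucc i
    · obtain ⟨j', h2, h3, h4⟩ := ih h1
      exact ⟨j', h2, h3.trans Fin.castSucc_lt_succ.le, h4⟩
    · refine ⟨j, ?_, le_rfl, lt_of_le_of_lt (not_lt.1 h1) h⟩
      by_contra hc
      have : j.succ ≤ p := Fin.castSucc_lt_iff_succ_le.1 (not_le.1 hc)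
      exact absurd (hσ this i) (not_le.2 h)

/-- Disjointness of the sets $I(v_j,v_{j+1})$ means that each coordinate rises at most once along
the chain, which is what `not_three` says without reference to an ordering or to repetitions. -/
theorem formsSimplex_iff_isFace {k : ℕ} (v : Fin (k + 1) → ∀ i, V i) :
    FormsSimplex G v ↔ IsFace G (Finset.univ.image v) := by
  constructor
  · rintro ⟨π, h1, h2⟩
    set σ := v ∘ π with hσ
    have mono : Monotone σ := Fin.monotone_iff_le_succ.2 fun j => (h1 j).1
    have mem : ∀ u ∈ Finset.univ.image v, ∃ p, σ p = u := by
      intro u hu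
      obtain ⟨p, -, rfl⟩ := Finset.mem_image.1 hu
      exact ⟨π.symm p, by simp [hσ]⟩
    have uniq : ∀ (i : Fin d) (j j' : Fin k), σ j.castSucc i < σ j.succ i →
        σ j'.castSucc i < σ j'.succ i → j = j' := by
      intro i j j' h h'
      by_contra hne
      exact Set.disjoint_left.1 (h2 j j' hne) h h'
    have adj : ∀ (p q : Fin (k + 1)) (i : Fin d), σ p i < σ q i → (G i).Adj (σ p i) (σ q i) := by
      intro p q i h
      obtain ⟨j, hj1, hj2, hj3⟩ := exists_rise mono i p q h
      have e1 : σ p i = σ j.castSucc i := by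
        refine (mono hj1 i).eq_or_lt.resolve_right fun hlt => ?_
        obtain ⟨j', -, h', h''⟩ := exists_rise mono i _ _ hlt
        rw [uniq i j' j h'' hj3] at h'
        exact absurd h' (not_le.2 Fin.castSucc_lt_succ)
      have e2 : σ j.succ i = σ q i := by
        refine (mono hj2 i).eq_or_lt.resolve_right fun hlt => ?_
        obtain ⟨j', h', -, h''⟩ := exists_rise mono i _ _ hlt
        rw [uniq i j' j h'' hj3] at h'
        exact absurd h' (not_le.2 Fin.castSucc_lt_succ)
      rw [e1, ← e2]
      exact ((h1 j).2 i).resolve_left hj3.ne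
    refine ⟨?_, ?_, ?_⟩
    · intro a ha b hb
      obtain ⟨p, rfl⟩ := mem a ha
      obtain ⟨q, rfl⟩ := mem b hb
      exact (le_total p q).imp (fun h => mono h) fun h => mono h
    · intro a ha b hb i
      obtain ⟨p, rfl⟩ := mem a ha
      obtain ⟨q, rfl⟩ := mem b hb
      rcases lt_trichotomy (σ p i) (σ q i) with h | h | h
      · exact Or.inr (adj p q i h)
      · exact Or.inl h
      · exact Or.inr (adj q p i h).symm
    · intro a ha b hb c hc i hab hbc
      obtain ⟨p, rfl⟩ := mem a ha
      obtain ⟨q, rfl⟩ := mem b hb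
      obtain ⟨r, rfl⟩ := mem c hc
      obtain ⟨j, -, hj, h⟩ := exists_rise mono i p q hab
      obtain ⟨j', hj', -, h'⟩ := exists_rise mono i q r hbc
      rw [uniq i j' j h' h] at hj'
      exact absurd (hj.trans hj') (not_le.2 Fin.castSucc_lt_succ)
  · intro hv
    have mem : ∀ j, v j ∈ Finset.univ.image v := fun j =>
      Finset.mem_image_of_mem _ (Finset.mem_univ _)
    -- The lexicographic order is a linear extension of the product order, so sorting by it puts a
    -- chain in increasing order.
    refine ⟨Tuple.sort fun j => toLex (v j), ?_⟩
    set π := Tuple.sort fun j => toLex (v j)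
    have hm : Monotone fun j => toLex (v (π j)) := Tuple.monotone_sort fun j => toLex (v j)
    have mono : Monotone (v ∘ π) := by
      intro p q hpq
      rcases hv.total _ (mem (π p)) _ (mem (π q)) with h | h
      · exact h
      · have := le_antisymm (hm hpq) (Pi.toLex_monotone h)
        exact (toLex.injective this).le
    refine ⟨fun j => ⟨mono Fin.castSucc_lt_succ.le, hv.adj _ (mem _) _ (mem _)⟩, ?_⟩
    have key : ∀ (i : Fin d) (j j' : Fin k), j < j' → (v ∘ π) j.castSucc i < (v ∘ π) j.succ i →
        (v ∘ π) j'.castSucc i < (v ∘ π) j'.succ i → False := by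
      intro i j j' hlt h h'
      have hle : (v ∘ π) j.succ i ≤ (v ∘ π) j'.castSucc i :=
        mono (by simpa [Fin.le_def] using hlt) i
      exact hv.not_three _ (mem _) _ (mem _) _ (mem _) i h (hle.trans_lt h')
    intro j j' hne
    refine Set.disjoint_left.2 fun i h h' => ?_
    rcases lt_or_gt_of_ne hne with hlt | hlt
    · exact key i j j' hlt h h'
    · exact key i j' j hlt h' h

/-! ### Inversions, directions and descents -/

open Classical in
/-- The inversions of a set of vertices: pairs `i < l` such that some `v ∈ S` has already increased
at `l` and has still to increase at `i`. -/
noncomputable def invs (S : Finset (∀ i, V i)) : Finset (Fin d × Fin d) :=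
  Finset.univ.filter fun p => p.1 < p.2 ∧
    ∃ v ∈ S, (∃ a ∈ S, a p.2 < v p.2) ∧ ∃ b ∈ S, v p.1 < b p.1

open Classical in
/-- The directions in which a set of vertices is not constant. -/
noncomputable def dirs (S : Finset (∀ i, V i)) : Finset (Fin d) :=
  Finset.univ.filter fun i => ∃ a ∈ S, ∃ b ∈ S, a i < b i

theorem mem_invs {i l : Fin d} : (i, l) ∈ invs S ↔
    i < l ∧ ∃ v ∈ S, (∃ a ∈ S, a l < v l) ∧ ∃ b ∈ S, v i < b i := by
  simp [invs]

theorem mem_dirs {i : Fin d} : i ∈ dirs S ↔ ∃ a ∈ S, ∃ b ∈ S, a i < b i := by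
  simp [dirs]

theorem invs_mono {S T : Finset (∀ i, V i)} (h : S ⊆ T) : invs S ⊆ invs T := by
  rintro ⟨i, l⟩ hp
  obtain ⟨hil, v, hv, ⟨a, ha, hav⟩, b, hb, hvb⟩ := mem_invs.1 hp
  exact mem_invs.2 ⟨hil, v, h hv, ⟨a, h ha, hav⟩, b, h hb, hvb⟩

theorem card_invs_le (S : Finset (∀ i, V i)) : (invs S).card ≤ d * d := by
  simpa using Finset.card_le_univ (invs S)

theorem dirs_mono {S T : Finset (∀ i, V i)} (h : S ⊆ T) : dirs S ⊆ dirs T := by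
  intro i hi
  obtain ⟨a, ha, b, hb, hab⟩ := mem_dirs.1 hi
  exact mem_dirs.2 ⟨a, h ha, b, h hb, hab⟩

/-- The faces whose monomials are a basis of the Chow ring: each vertex that is neither the first
nor the last one is a descent, that is, it has an inversion that no other vertex has. -/
structure IsBasic (G : ∀ i, SimpleGraph (V i)) (S : Finset (∀ i, V i)) : Prop where
  isFace : IsFace G S
  descent : ∀ v ∈ S, (∃ a ∈ S, a < v) → (∃ b ∈ S, v < b) →
    ∃ i l, i < l ∧ (∃ a ∈ S, a l < v l) ∧ (∃ b ∈ S, v i < b i) ∧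
      ∀ w ∈ S, w l = v l → w i = v i → w = v

/-- The vertex of a face that precedes a given one. -/
theorem IsFace.exists_pred (hS : IsFace G S) {v : ∀ i, V i} (h : ∃ a ∈ S, a < v) :
    ∃ a ∈ S, a < v ∧ ∀ x ∈ S, x < v → x ≤ a := by
  classical
  obtain ⟨a, ha, hmax⟩ := (S.filter (· < v)).exists_maximal
    (by obtain ⟨a, ha, hav⟩ := h; exact ⟨a, by simp [ha, hav]⟩)
  simp only [Finset.mem_filter] at ha
  refine ⟨a, ha.1, ha.2, fun x hx hxv => ?_⟩
  rcases hS.total x hx a ha.1 with h | h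
  · exact h
  · exact hmax (by simp [hx, hxv]) h

/-- The vertex of a face that follows a given one. -/
theorem IsFace.exists_succ (hS : IsFace G S) {v : ∀ i, V i} (h : ∃ b ∈ S, v < b) :
    ∃ b ∈ S, v < b ∧ ∀ x ∈ S, v < x → b ≤ x := by
  classical
  obtain ⟨b, hb, hmin⟩ := (S.filter (v < ·)).exists_minimal
    (by obtain ⟨a, ha, hav⟩ := h; exact ⟨a, by simp [ha, hav]⟩)
  simp only [Finset.mem_filter] at hb
  refine ⟨b, hb.1, hb.2, fun x hx hxv => ?_⟩
  rcases hS.total b hb.1 x hx with h | h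
  · exact h
  · exact hmin (by simp [hx, hxv]) h

theorem IsFace.lt_or_eq_or_gt (hS : IsFace G S) {u v : ∀ i, V i} (hu : u ∈ S) (hv : v ∈ S) :
    u < v ∨ u = v ∨ v < u := by
  rcases hS.total u hu v hv with h | h
  · exact h.lt_or_eq.imp_right Or.inl
  · rcases h.lt_or_eq with h | h
    · exact Or.inr (Or.inr h)
    · exact Or.inr (Or.inl h.symm)

/-- If `v` is not a descent of the face `S`, then removing it does not change the inversions. -/
theorem invs_subset_erase {S : Finset (∀ i, V i)} {v a b : ∀ i, V i}
    (ha : a ∈ S) (hb : b ∈ S) (hav : a < v) (hvb : v < b)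
    (hlt : ∀ i l, a i < v i → v l < b l → i < l) : invs S ⊆ invs (S.erase v) := by
  have ha' : a ∈ S.erase v := Finset.mem_erase.2 ⟨hav.ne, ha⟩
  have hb' : b ∈ S.erase v := Finset.mem_erase.2 ⟨hvb.ne', hb⟩
  rintro ⟨i, l⟩ hp
  obtain ⟨hil, x, hx, ⟨a₀, ha₀, hax⟩, b₀, hb₀, hxb⟩ := mem_invs.1 hp
  have low : ∃ y ∈ S.erase v, y l ≤ a₀ l := by
    by_cases e : a₀ = v
    · exact ⟨a, ha', e ▸ hav.le l⟩
    · exact ⟨a₀, Finset.mem_erase.2 ⟨e, ha₀⟩, le_rfl⟩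
  have high : ∃ y ∈ S.erase v, b₀ i ≤ y i := by
    by_cases e : b₀ = v
    · exact ⟨b, hb', e ▸ hvb.le i⟩
    · exact ⟨b₀, Finset.mem_erase.2 ⟨e, hb₀⟩, le_rfl⟩
  obtain ⟨y, hy, hya⟩ := low
  obtain ⟨z, hz, hbz⟩ := high
  by_cases e : x = v
  · subst e
    -- The witness `v` can be replaced by `a` if `l` has already risen at `a`, and by `b` if `i` has
    -- not yet risen at `b`. Otherwise `l` rises into `v` and `i` rises out of it, so `l < i` by
    -- `hlt`.
    by_cases h1 : a l = x l
    · exact mem_invs.2 ⟨hil, a, ha', ⟨y, hy, h1 ▸ hya.trans_lt hax⟩, z, hz,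
        (hav.le i).trans_lt (hxb.trans_le hbz)⟩
    by_cases h2 : b i = x i
    · exact mem_invs.2 ⟨hil, b, hb', ⟨y, hy, (hya.trans_lt hax).trans_le (hvb.le l)⟩, z, hz,
        h2 ▸ hxb.trans_le hbz⟩
    exact absurd (hlt l i (lt_of_le_of_ne (hav.le l) h1) (lt_of_le_of_ne (hvb.le i) (Ne.symm h2)))
      (not_lt.2 hil.le)
  · exact mem_invs.2 ⟨hil, x, Finset.mem_erase.2 ⟨e, hx⟩, ⟨y, hy, hya.trans_lt hax⟩, z, hz,
      hxb.trans_le hbz⟩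

/-- Inserting a vertex between two consecutive vertices of a face, with an inversion between the
directions that change, gives new inversions. -/
theorem invs_ssubset_insert {R : Finset (∀ i, V i)} (hR : IsFace G R) {a b x : ∀ i, V i}
    (ha : a ∈ R) (hb : b ∈ R) (hab : ∀ y ∈ R, y ≤ a ∨ b ≤ y) {p q : Fin d}
    (hpq : p < q) (hp : a p < b p) (hq : a q < b q) (hxq : a q < x q) (hxp : x p < b p) :
    invs R ⊂ invs (insert x R) := by
  refine Finset.ssubset_iff_subset_ne.2 ⟨invs_mono (Finset.subset_insert _ _), fun e => ?_⟩
  have h : (p, q) ∈ invs (insert x R) := mem_invs.2 ⟨hpq, x, Finset.mem_insert_self _ _,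
    ⟨a, Finset.mem_insert_of_mem ha, hxq⟩, b, Finset.mem_insert_of_mem hb, hxp⟩
  rw [← e] at h
  obtain ⟨-, y, hy, ⟨c, hc, hcy⟩, c', hc', hyc'⟩ := mem_invs.1 h
  -- The directions `p` and `q` both rise in the single step from `a` to `b` of `R`, so no vertex of
  -- `R` separates them.
  rcases hab y hy with h' | h'
  · exact hR.not_three c hc y hy b hb q hcy ((h' q).trans_lt hq)
  · exact hR.not_three a ha y hy c' hc' p (hp.trans_le (h' p)) hyc'

end Faces

/-! ### Monomials indexed by multisets -/

section Monomials

variable {σ : Type u}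

/-- The monomial given by a multiset of variables. -/
noncomputable def mon (s : Multiset σ) : MvPolynomial σ ℤ := (s.map X).prod

theorem mon_zero : mon (0 : Multiset σ) = 1 := by simp [mon]

theorem mon_cons (a : σ) (s : Multiset σ) : mon (a ::ₘ s) = X a * mon s := by simp [mon]

theorem mon_add (s t : Multiset σ) : mon (s + t) = mon s * mon t := by simp [mon]

theorem monomial_eq_smul_mon (m : σ →₀ ℕ) (c : ℤ) :
    monomial m c = c • mon (Finsupp.toMultiset m) := by
  rw [mon, Finsupp.toMultiset_map, Finsupp.prod_toMultiset, Finsupp.prod_mapDomain_index]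
  · rw [monomial_eq, zsmul_eq_mul]
    rfl
  · simp
  · intro b m n
    exact pow_add b m n

theorem mon_mul_sum (s : Multiset σ) (T : Finset σ) :
    mon s * ∑ v ∈ T, X v = ∑ v ∈ T, mon (v ::ₘ s) := by
  rw [Finset.mul_sum]
  exact Finset.sum_congr rfl fun v _ => by rw [mon_cons, mul_comm]

theorem isHomogeneous_mon (s : Multiset σ) : (mon s).IsHomogeneous s.card := by
  induction s using Multiset.induction_on with
  | empty => simpa [mon_zero] using isHomogeneous_one σ ℤ
  | cons a s ih =>
    rw [mon_cons, Multiset.card_cons, add_comm]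
    exact (isHomogeneous_X ℤ a).mul ih

/-- An additive subgroup that contains the monomials of degree `k` contains the homogeneous
polynomials of degree `k`. -/
theorem mem_of_isHomogeneous {N : AddSubgroup (MvPolynomial σ ℤ)} {k : ℕ}
    (hN : ∀ s : Multiset σ, s.card = k → mon s ∈ N) {p : MvPolynomial σ ℤ}
    (hp : p.IsHomogeneous k) : p ∈ N := by
  rw [p.as_sum]
  refine N.sum_mem fun m hm => ?_
  rw [monomial_eq_smul_mon]
  refine N.zsmul_mem (hN _ ?_) _
  rw [Finsupp.card_toMultiset]
  have := hp (mem_support_iff.1 hm)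
  simpa [Finsupp.weight_apply, Finsupp.sum] using this

/-- An additive subgroup that contains all monomials is everything. -/
theorem mem_of_forall_mon {N : AddSubgroup (MvPolynomial σ ℤ)}
    (hN : ∀ s : Multiset σ, mon s ∈ N) (p : MvPolynomial σ ℤ) : p ∈ N := by
  rw [p.as_sum]
  refine N.sum_mem fun m hm => ?_
  rw [monomial_eq_smul_mon]
  exact N.zsmul_mem (hN _) _

end Monomials

/-! ### Spanning: reduction to basic faces -/

section Straightening

variable {d : ℕ} {V : Fin d → Type u} [∀ i, LinearOrder (V i)] [∀ i, Fintype (V i)]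

/-- Closure properties of an additive subgroup of polynomials under which it contains all
monomials of degree `k` as soon as it contains those of the basic faces. -/
structure Straightens (G : ∀ i, SimpleGraph (V i)) (k : ℕ)
    (N : AddSubgroup (MvPolynomial (∀ i, V i) ℤ)) : Prop where
  of_not_isFace : ∀ s : Multiset (∀ i, V i), s.card = k → ¬ IsFace G s.toFinset → mon s ∈ N
  of_isBasic : ∀ S : Finset (∀ i, V i), S.card = k → IsBasic G S → mon S.val ∈ N
  mul_sum : ∀ s : Multiset (∀ i, V i), s.card + 1 = k → s ≠ 0 → mon s * ∑ v, X v ∈ N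
  mul_sum_filter : ∀ (s : Multiset (∀ i, V i)) (u w : ∀ i, V i) (i : Fin d), s.card + 1 = k →
    u ∈ s → w ∈ s → u i ≠ w i → mon s * ∑ v : ∀ i, V i with v i = u i, X v ∈ N

variable {G : ∀ i, SimpleGraph (V i)} {k : ℕ} {N : AddSubgroup (MvPolynomial (∀ i, V i) ℤ)}

/-- For a vertex `w` of the support of `s` there is a linear form that annihilates the monomial of
`s` modulo `N` and whose variables in the support are those up to `w`. -/
theorem Straightens.exists_form_le (hN : Straightens G k N) {s : Multiset (∀ i, V i)}
    (hs : s.card + 1 = k) (hS : IsFace G s.toFinset) {w : ∀ i, V i} (hw : w ∈ s) :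
    ∃ T : Finset (∀ i, V i), (∀ v ∈ s, v ∈ T ↔ v ≤ w) ∧ ∑ v ∈ T, mon (v ::ₘ s) ∈ N := by
  by_cases h : ∃ b ∈ s.toFinset, w < b
  · obtain ⟨b, hb, hwb, hmin⟩ := hS.exists_succ h
    obtain ⟨i, hi⟩ := exists_lt_apply hwb
    have hw' : w ∈ s.toFinset := Multiset.mem_toFinset.2 hw
    refine ⟨Finset.univ.filter fun v => v i = w i, fun v hv => ?_, ?_⟩
    · have hv' : v ∈ s.toFinset := Multiset.mem_toFinset.2 hv
      simp only [Finset.mem_filter, Finset.mem_univ, true_and]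
      constructor
      · intro e
        rcases hS.lt_or_eq_or_gt hv' hw' with h1 | h1 | h1
        · exact h1.le
        · exact h1.le
        · have := (hmin v hv' h1) i
          rw [e] at this
          exact absurd this (not_le.2 hi)
      · exact fun hle => hS.eq_of_le_of_lt hw' hb hv' (hle i) hi
    · rw [← mon_mul_sum]
      exact hN.mul_sum_filter s w b i hs hw (Multiset.mem_toFinset.1 hb) hi.ne
  · refine ⟨Finset.univ, fun v hv => ?_, ?_⟩
    · simp only [Finset.mem_univ, true_iff]
      rcases hS.lt_or_eq_or_gt (Multiset.mem_toFinset.2 hv) (Multiset.mem_toFinset.2 hw)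
        with h1 | h1 | h1
      · exact h1.le
      · exact h1.le
      · exact (h ⟨v, Multiset.mem_toFinset.2 hv, h1⟩).elim
    · rw [← mon_mul_sum]
      exact hN.mul_sum s hs fun e => by simp [e] at hw

theorem Straightens.exists_form_lt (hN : Straightens G k N) {s : Multiset (∀ i, V i)}
    (hs : s.card + 1 = k) (hS : IsFace G s.toFinset) {w : ∀ i, V i} :
    ∃ T : Finset (∀ i, V i), (∀ v ∈ s, v ∈ T ↔ v < w) ∧ ∑ v ∈ T, mon (v ::ₘ s) ∈ N := by
  by_cases h : ∃ a ∈ s.toFinset, a < w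
  · obtain ⟨a, ha, haw, hmax⟩ := hS.exists_pred h
    obtain ⟨T, hT, hTN⟩ := hN.exists_form_le hs hS (Multiset.mem_toFinset.1 ha)
    exact ⟨T, fun v hv => (hT v hv).trans
      ⟨fun hle => hle.trans_lt haw, hmax v (Multiset.mem_toFinset.2 hv)⟩, hTN⟩
  · refine ⟨∅, fun v hv => ?_, by simp⟩
    simp only [Finset.notMem_empty, false_iff]
    exact fun hlt => h ⟨v, Multiset.mem_toFinset.2 hv, hlt⟩

/-- Monomials that are not square free are reduced to monomials with larger support. -/
theorem Straightens.mon_cons_mem (hN : Straightens G k N) {s : Multiset (∀ i, V i)}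
    (hs : s.card + 1 = k) (hS : IsFace G s.toFinset) {u : ∀ i, V i} (hu : u ∈ s)
    (ih : ∀ v, v ∉ s → mon (v ::ₘ s) ∈ N) : mon (u ::ₘ s) ∈ N := by
  classical
  -- Among the variables of the support, the forms for `≤ u` and `< u` differ exactly by `u`. All
  -- other variables enlarge the support, where `ih` applies.
  obtain ⟨T, hT, hTN⟩ := hN.exists_form_le hs hS hu
  obtain ⟨T', hT', hTN'⟩ := hN.exists_form_lt hs hS (w := u)
  have split : ∀ U : Finset (∀ i, V i), ∑ v ∈ U, mon (v ::ₘ s) ∈ N →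
      ∑ v ∈ U with v ∈ s, mon (v ::ₘ s) ∈ N := by
    intro U hU
    rw [← Finset.sum_filter_add_sum_filter_not U (· ∈ s)] at hU
    refine (N.add_mem_cancel_right (N.sum_mem fun v hv => ih v ?_)).1 hU
    exact (Finset.mem_filter.1 hv).2
  have e : T.filter (· ∈ s) = insert u (T'.filter (· ∈ s)) := by
    ext v
    simp only [Finset.mem_filter, Finset.mem_insert]
    constructor
    · rintro ⟨h1, h2⟩
      rcases ((hT v h2).1 h1).lt_or_eq with h | h
      · exact Or.inr ⟨(hT' v h2).2 h, h2⟩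
      · exact Or.inl h
    · rintro (rfl | ⟨h1, h2⟩)
      · exact ⟨(hT _ hu).2 le_rfl, hu⟩
      · exact ⟨(hT v h2).2 ((hT' v h2).1 h1).le, h2⟩
  have h1 := split T hTN
  rw [e, Finset.sum_insert (by
    simp only [Finset.mem_filter, not_and]
    exact fun h _ => lt_irrefl u ((hT' u hu).1 h))] at h1
  exact (N.add_mem_cancel_right (split T' hTN')).1 h1

/-- The monomial of a face that is not basic is reduced to monomials of faces with the same number
of vertices and more inversions. -/
theorem Straightens.mon_mem_of_not_isBasic (hN : Straightens G k N) {S : Finset (∀ i, V i)}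
    (hSk : S.card = k) (hS : IsFace G S) (hb : ¬ IsBasic G S)
    (ih : ∀ T : Finset (∀ i, V i), T.card = k → invs S ⊂ invs T → mon T.val ∈ N) :
    mon S.val ∈ N := by
  have hex : ∃ v ∈ S, (∃ a ∈ S, a < v) ∧ (∃ b ∈ S, v < b) ∧ ∀ i l, i < l →
      (∃ a ∈ S, a l < v l) → (∃ b ∈ S, v i < b i) → ∃ w ∈ S, w l = v l ∧ w i = v i ∧ w ≠ v := by
    by_contra hc
    refine hb ⟨hS, fun v hv ha hb => ?_⟩
    by_contra hc'
    refine hc ⟨v, hv, ha, hb, fun i l hil h1 h2 => ?_⟩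
    by_contra hc''
    refine hc' ⟨i, l, hil, h1, h2, fun w hw e1 e2 => ?_⟩
    by_contra hne
    exact hc'' ⟨w, hw, e1, e2, hne⟩
  obtain ⟨v, hv, hva, hvb, hnd⟩ := hex
  obtain ⟨a, ha, hav, hmax⟩ := hS.exists_pred hva
  obtain ⟨b, hb, hvb, hmin⟩ := hS.exists_succ hvb
  -- At a non-descent, each direction rising into `v` precedes each direction rising out of it: in
  -- the opposite case another vertex would share both coordinates with `v`, but it would lie below
  -- `a` or above `b`.
  have hlt : ∀ i l, a i < v i → v l < b l → i < l := by
    intro i l hi hl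
    by_contra hc
    rcases (not_lt.1 hc).eq_or_lt with e | hli
    · subst e
      exact hS.not_three a ha v hv b hb _ hi hl
    obtain ⟨w, hw, e1, e2, hne⟩ := hnd l i hli ⟨a, ha, hi⟩ ⟨b, hb, hl⟩
    rcases hS.lt_or_eq_or_gt hw hv with h | h | h
    · exact absurd (hmax w hw h i) (not_le.2 (e1 ▸ hi))
    · exact hne h
    · exact absurd (hmin w hw h l) (not_le.2 (e2 ▸ hl))
  -- The last direction `i` entering `v` and the first direction `l` leaving it. With this extremal
  -- choice, `v` is the only vertex between `a` and `b` that has risen at `i`, not at `l`, and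
  -- yields no new inversion.
  obtain ⟨i, hi, hi_max⟩ := (Finset.univ.filter fun i => a i < v i).exists_max_image id
    (by obtain ⟨i, hi⟩ := exists_lt_apply hav; exact ⟨i, by simpa using hi⟩)
  obtain ⟨l, hl, hl_min⟩ := (Finset.univ.filter fun l => v l < b l).exists_min_image id
    (by obtain ⟨i, hi⟩ := exists_lt_apply hvb; exact ⟨i, by simpa using hi⟩)
  simp only [Finset.mem_filter, Finset.mem_univ, true_and, id] at hi hi_max hl hl_min
  have hil := hlt i l hi hl
  have hiab : a i < b i := hi.trans_le (hvb.le i)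
  have hlab : a l < b l := (hav.le l).trans_lt hl
  set R := S.erase v with hR
  have haR : a ∈ R := Finset.mem_erase.2 ⟨hav.ne, ha⟩
  have hbR : b ∈ R := Finset.mem_erase.2 ⟨hvb.ne', hb⟩
  have hRk : R.val.card + 1 = k := by
    rw [← hSk]
    exact Finset.card_erase_add_one hv
  have hinv : invs S ⊆ invs R := invs_subset_erase ha hb hav hvb hlt
  have hgap : ∀ y ∈ R, y ≤ a ∨ b ≤ y := by
    intro y hy
    obtain ⟨hne, hy⟩ := Finset.mem_erase.1 hy
    rcases hS.lt_or_eq_or_gt hy hv with h | h | h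
    · exact Or.inl (hmax y hy h)
    · exact (hne h).elim
    · exact Or.inr (hmin y hy h)
  have hRface : IsFace G R := hS.subset (Finset.erase_subset _ _)
  have red : ∀ x, x ∉ R → (IsFace G (insert x R) → ∃ p q, p < q ∧ a p < b p ∧ a q < b q ∧
      a q < x q ∧ x p < b p) → mon (x ::ₘ R.val) ∈ N := by
    intro x hx hpq
    have e : (insert x R).val = x ::ₘ R.val := Finset.insert_val_of_notMem hx
    have ek : (insert x R).card = k := by rw [Finset.card_insert_of_notMem hx]; exact hRk
    rw [← e]
    by_cases hf : IsFace G (insert x R)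
    · obtain ⟨p, q, h, hp, hq, hxq, hxp⟩ := hpq hf
      exact ih _ ek
        (hinv.trans_ssubset (invs_ssubset_insert hRface haR hbR hgap h hp hq hxq hxp))
    · exact hN.of_not_isFace _ ek (by rwa [Finset.val_toFinset])
  set T₁ : Finset (∀ i, V i) := Finset.univ.filter fun x => x i = a i
  set T₂ : Finset (∀ i, V i) := Finset.univ.filter fun x => x l = a l
  have r₁ : ∑ x ∈ T₁, mon (x ::ₘ R.val) ∈ N := by
    rw [← mon_mul_sum]
    exact hN.mul_sum_filter _ a b i hRk haR hbR hiab.ne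
  have r₂ : ∑ x ∈ T₂, mon (x ::ₘ R.val) ∈ N := by
    rw [← mon_mul_sum]
    exact hN.mul_sum_filter _ a b l hRk haR hbR hlab.ne
  -- The variables of `R` cancel in the difference of the two forms, by `low`. A remaining `x` that
  -- forms a face with `R` has inversion `(i, l)` if it comes from `T₁`. If it comes from `T₂` and
  -- differs from `v` at `j`, it has inversion `(j, i)` or `(l, j)`.
  have r := N.sub_mem r₁ r₂
  rw [← Finset.sum_sdiff_sub_sum_sdiff] at r
  have low : ∀ y ∈ R, y i = a i ↔ y l = a l := by
    intro y hy
    rcases hgap y hy with h | h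
    · exact iff_of_true (hRface.eq_of_le_of_lt haR hbR hy (h i) hiab)
        (hRface.eq_of_le_of_lt haR hbR hy (h l) hlab)
    · exact iff_of_false (hiab.trans_le (h i)).ne' (hlab.trans_le (h l)).ne'
  have m₁ : ∑ x ∈ T₁ \ T₂, mon (x ::ₘ R.val) ∈ N := by
    refine N.sum_mem fun x hx => ?_
    simp only [T₁, T₂, Finset.mem_sdiff, Finset.mem_filter, Finset.mem_univ, true_and] at hx
    refine red x (fun hxR => hx.2 ((low x hxR).1 hx.1)) fun hf => ?_
    have := hf.eq_of_lt_of_ne (Finset.mem_insert_of_mem haR) (Finset.mem_insert_of_mem hbR)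
      (Finset.mem_insert_self x R) hlab hx.2
    exact ⟨i, l, hil, hiab, hlab, this ▸ hlab, hx.1 ▸ hiab⟩
  have hv₂ : v ∈ T₂ \ T₁ := by
    simp only [T₁, T₂, Finset.mem_sdiff, Finset.mem_filter, Finset.mem_univ, true_and]
    refine ⟨?_, hi.ne'⟩
    by_contra hne
    exact hS.not_three a ha v hv b hb l (lt_of_le_of_ne (hav.le l) (Ne.symm hne)) hl
  have m₂ : ∑ x ∈ (T₂ \ T₁).erase v, mon (x ::ₘ R.val) ∈ N := by
    refine N.sum_mem fun x hx => ?_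
    simp only [T₁, T₂, Finset.mem_sdiff, Finset.mem_filter, Finset.mem_univ, true_and,
      Finset.mem_erase] at hx
    obtain ⟨hxv, hxl, hxi⟩ := hx
    refine red x (fun hxR => hxi ((low x hxR).2 hxl)) fun hf => ?_
    have haI := Finset.mem_insert_of_mem (b := x) haR
    have hbI := Finset.mem_insert_of_mem (b := x) hbR
    have hxI := Finset.mem_insert_self x R
    have hxi' := hf.eq_of_lt_of_ne haI hbI hxI hiab hxi
    have hax : a ≤ x := hf.le_of_lt_apply haI hxI (hxi' ▸ hiab)
    have hxb : x ≤ b := hf.le_of_lt_apply hxI hbI (hxl ▸ hlab)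
    obtain ⟨j, hj⟩ := Function.ne_iff.1 hxv
    have hjab : a j < b j := by
      refine lt_of_le_of_ne ((hax j).trans (hxb j)) fun e => hj ?_
      rw [le_antisymm (e ▸ hxb j) (hax j), le_antisymm (e ▸ hvb.le j) (hav.le j)]
    by_cases hxj : x j = a j
    · have hvj := hS.eq_of_lt_of_ne ha hb hv hjab fun e => hj (hxj.trans e.symm)
      refine ⟨j, i, lt_of_le_of_ne (hi_max j (hvj ▸ hjab)) ?_, hjab, hiab, hxi' ▸ hiab,
        hxj ▸ hjab⟩
      rintro rfl
      exact hxi hxj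
    · have hxj' := hf.eq_of_lt_of_ne haI hbI hxI hjab hxj
      have hvj : v j = a j := by
        by_contra hne
        exact hj (hxj'.trans (hS.eq_of_lt_of_ne ha hb hv hjab hne).symm)
      refine ⟨l, j, lt_of_le_of_ne (hl_min j (hvj ▸ hjab)) ?_, hlab, hjab, hxj' ▸ hjab,
        hxl ▸ hlab⟩
      rintro rfl
      exact hxj hxl
  rw [← Finset.add_sum_erase _ _ hv₂] at r
  have hfin := (N.add_mem_cancel_right m₂).1 (by simpa using N.sub_mem m₁ r)
  have eS : v ::ₘ R.val = S.val := by
    rw [hR, Finset.erase_val]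
    exact Multiset.cons_erase hv
  rwa [eS] at hfin

/-- A subgroup that is closed under straightening contains all monomials of degree `k`. -/
theorem Straightens.mon_mem (hN : Straightens G k N) (s : Multiset (∀ i, V i)) (hs : s.card = k) :
    mon s ∈ N := by
  classical
  -- Decreasing lexicographic induction on (size of the support, number of inversions). The weight
  -- `d * d + 1` exceeds any number of inversions.
  induction hn : k * (d * d + 1) + d * d -
    (s.toFinset.card * (d * d + 1) + (invs s.toFinset).card) using Nat.strong_induction_on
    generalizing s with
  | _ n ih =>
  subst hn
  have bound : ∀ t : Multiset (∀ i, V i), t.card = k →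
      t.toFinset.card * (d * d + 1) + (invs t.toFinset).card ≤ k * (d * d + 1) + d * d :=
    fun t ht => add_le_add (Nat.mul_le_mul_right _ (ht ▸ Multiset.toFinset_card_le t))
      (card_invs_le _)
  have ih' : ∀ t : Multiset (∀ i, V i), t.card = k →
      s.toFinset.card * (d * d + 1) + (invs s.toFinset).card <
        t.toFinset.card * (d * d + 1) + (invs t.toFinset).card → mon t ∈ N := by
    intro t ht hlt
    refine ih _ ?_ t ht rfl
    have := bound t ht
    omega
  by_cases hf : IsFace G s.toFinset
  swap
  · exact hN.of_not_isFace s hs hf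
  by_cases hnd : s.Nodup
  · have es : s.toFinset.val = s := by rw [Multiset.toFinset_val, hnd.dedup]
    have ec : s.toFinset.card = k := by rw [← hs, Finset.card_def, es]
    rw [← es]
    by_cases hb : IsBasic G s.toFinset
    · exact hN.of_isBasic _ ec hb
    · refine hN.mon_mem_of_not_isBasic ec hf hb fun T hT hlt => ih' _ hT ?_
      have := Finset.card_lt_card hlt
      rw [Finset.val_toFinset, ec, hT]
      omega
  · obtain ⟨u, hu⟩ : ∃ u, 2 ≤ s.count u := by
      by_contra hc
      push Not at hc
      exact hnd (Multiset.nodup_iff_count_le_one.2 fun u => Nat.lt_succ_iff.1 (hc u))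
    have hus : u ∈ s := Multiset.count_pos.1 (by omega)
    have hus' : u ∈ s.erase u := by
      rw [← Multiset.count_pos, Multiset.count_erase_self]
      omega
    have es : u ::ₘ s.erase u = s := Multiset.cons_erase hus
    have et : (s.erase u).toFinset = s.toFinset := by
      rw [← es, Multiset.toFinset_cons, Multiset.erase_cons_head]
      exact (Finset.insert_eq_of_mem (Multiset.mem_toFinset.2 hus')).symm
    have ek : (s.erase u).card + 1 = k := by rw [← hs, Multiset.card_erase_add_one hus]
    rw [← es]
    refine hN.mon_cons_mem ek (et ▸ hf) hus' fun v hv => ih' _ (by simpa using ek) ?_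
    have hv' : v ∉ s.toFinset := by rwa [← et, Multiset.mem_toFinset]
    rw [Multiset.toFinset_cons, et, Finset.card_insert_of_notMem hv', add_mul]
    have := card_invs_le s.toFinset
    omega

end Straightening

/-! ### Zeros of the deformed relations -/

section Points

variable {d : ℕ} {V : Fin d → Type u} [∀ i, LinearOrder (V i)]

/-- The vertices of the path from `lo` to `hi` that changes the coordinates in the order `π`. -/
def stage (lo hi : ∀ i, V i) (π : Equiv.Perm (Fin d)) (j : ℕ) : ∀ i, V i :=
  fun i => if (π.symm i : ℕ) < j then hi i else lo i

/-- The coordinates, in the order `π`, of a fixed generic point, preceded by `1` and followed by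
`0`. -/
def level (π : Equiv.Perm (Fin d)) : ℕ → ℤ
  | 0 => 1
  | j + 1 => if h : j < d then ((π ⟨j, h⟩ : ℕ) : ℤ) + 2 else 0

/-- The barycentric coordinates of the generic point with respect to the vertices of a path. -/
def stageWeight (lo hi : ∀ i, V i) (π : Equiv.Perm (Fin d)) (v : ∀ i, V i) : ℤ :=
  ∑ j ∈ Finset.range (d + 1), if stage lo hi π j = v then level π j - level π (j + 1) else 0

variable {lo hi : ∀ i, V i} {π : Equiv.Perm (Fin d)}

theorem level_succ (i : Fin d) : level π ((π.symm i : ℕ) + 1) = (i : ℕ) + 2 := by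
  simp [level]

theorem level_last : level π (d + 1) = 0 := by simp [level]

/-- The coordinates `i + 2` are distinct, and the shift by 2 keeps them away from the boundary
values 1 and 0; this is the genericity of the point. -/
theorem level_ne {m n : ℕ} (hmn : m < n) (hn : n ≤ d + 1) : level π m ≠ level π n := by
  obtain ⟨n, rfl⟩ := Nat.exists_eq_succ_of_ne_zero (by omega : n ≠ 0)
  rcases m with _ | m
  · simp only [level]
    split_ifs <;> omega
  · have hm : m < d := by omega
    simp only [level, hm, dite_true]
    split_ifs with h
    · intro e
      have e' : (π ⟨m, hm⟩ : ℕ) = (π ⟨n, h⟩ : ℕ) := by omega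
      have := π.injective (Fin.ext e')
      simp only [Fin.mk.injEq] at this
      omega
    · omega

theorem stage_mono (h : lo ≤ hi) : Monotone (stage lo hi π) := by
  intro m n hmn i
  simp only [stage]
  split_ifs
  · exact le_rfl
  · omega
  · exact h i
  · exact le_rfl

theorem exists_stage_of_stageWeight_ne_zero {v : ∀ i, V i} (h : stageWeight lo hi π v ≠ 0) :
    ∃ j ≤ d, stage lo hi π j = v := by
  obtain ⟨j, hj, hne⟩ := Finset.exists_ne_zero_of_sum_ne_zero h
  exact ⟨j, Nat.lt_succ_iff.1 (Finset.mem_range.1 hj), by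
    by_contra hc
    simp [hc] at hne⟩

theorem sum_Ico_level {m n : ℕ} (h : m ≤ n) :
    ∑ j ∈ Finset.Ico m n, (level π j - level π (j + 1)) = level π m - level π n := by
  rw [← neg_inj, ← Finset.sum_neg_distrib]
  simp only [neg_sub]
  exact Finset.sum_Ico_sub _ h

/-- Directions with `lo i = hi i` make stages coincide. By monotonicity the indices of one vertex
form an interval, and its weight telescopes to a difference of two distinct levels. -/
theorem stageWeight_ne_zero (h : lo ≤ hi) {m : ℕ} (hm : m ≤ d) :
    stageWeight lo hi π (stage lo hi π m) ≠ 0 := by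
  set J := (Finset.range (d + 1)).filter fun j => stage lo hi π j = stage lo hi π m with hJ
  have hmem : ∀ j, j ∈ J ↔ j ≤ d ∧ stage lo hi π j = stage lo hi π m := by
    intro j
    simp [hJ]
  have hne : J.Nonempty := ⟨m, (hmem m).2 ⟨hm, rfl⟩⟩
  have eJ : J = Finset.Ico (J.min' hne) (J.max' hne + 1) := by
    ext j
    rw [Finset.mem_Ico]
    constructor
    · exact fun hj => ⟨J.min'_le j hj, Nat.lt_succ_iff.2 (J.le_max' j hj)⟩
    · rintro ⟨h1, h2⟩
      have h2 := Nat.lt_succ_iff.1 h2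
      obtain ⟨-, e1⟩ := (hmem _).1 (J.min'_mem hne)
      obtain ⟨e3, e2⟩ := (hmem _).1 (J.max'_mem hne)
      exact (hmem j).2 ⟨h2.trans e3, le_antisymm (e2 ▸ stage_mono h h2) (e1 ▸ stage_mono h h1)⟩
  have hle : J.min' hne ≤ J.max' hne := J.min'_le _ (J.max'_mem hne)
  rw [stageWeight, ← Finset.sum_filter, ← hJ, eJ, sum_Ico_level (by omega), sub_ne_zero]
  have := ((hmem _).1 (J.max'_mem hne)).1
  exact level_ne (by omega) (by omega)

variable [∀ i, Fintype (V i)]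

theorem sum_stageWeight (P : (∀ i, V i) → Prop) [DecidablePred P] :
    ∑ v : ∀ i, V i with P v, stageWeight lo hi π v =
      ∑ j ∈ Finset.range (d + 1) with P (stage lo hi π j), (level π j - level π (j + 1)) := by
  simp only [stageWeight]
  rw [Finset.sum_comm, Finset.sum_filter]
  refine Finset.sum_congr rfl fun j _ => ?_
  rw [Finset.sum_ite_eq]
  simp

theorem sum_stageWeight_univ : ∑ v : ∀ i, V i, stageWeight lo hi π v = 1 := by
  have := sum_stageWeight (lo := lo) (hi := hi) (π := π) fun _ => True
  simp only [Finset.filter_true] at this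
  rw [this, Finset.range_eq_Ico, sum_Ico_level (Nat.zero_le _), level_last]
  rfl

/-- Coordinate `i` is `hi i` exactly from stage `π.symm i + 1` on, so the sum telescopes to the
level there. The value does not depend on `π` or on the path, which makes the deformed relations
common to all points. -/
theorem sum_stageWeight_hi {i : Fin d} (h : lo i ≠ hi i) :
    ∑ v : ∀ i, V i with v i = hi i, stageWeight lo hi π v = (i : ℕ) + 2 := by
  rw [sum_stageWeight fun v => v i = hi i, ← level_succ (π := π), ← sub_zero (level π _),
    ← level_last (π := π), ← sum_Ico_level (by have := (π.symm i).2; omega)]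
  refine Finset.sum_congr ?_ fun _ _ => rfl
  ext j
  rw [Finset.mem_filter, Finset.mem_range, Finset.mem_Ico]
  simp only [stage]
  split_ifs with hj
  · simp; omega
  · simp [h]; omega

theorem sum_stageWeight_lo {i : Fin d} (h : lo i ≠ hi i) :
    ∑ v : ∀ i, V i with v i = lo i, stageWeight lo hi π v = 1 - ((i : ℕ) + 2) := by
  have h0 : (1 : ℤ) = level π 0 := rfl
  rw [sum_stageWeight fun v => v i = lo i, ← level_succ (π := π), h0,
    ← sum_Ico_level (by omega)]
  refine Finset.sum_congr ?_ fun _ _ => rfl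
  ext j
  have := (π.symm i).2
  rw [Finset.mem_filter, Finset.mem_range, Finset.mem_Ico]
  simp only [stage]
  split_ifs with hj
  · simp [Ne.symm h]; omega
  · simp; omega

/-- Integral points of the affine deformation of the relations of the Chow ring: families of values
for the variables `C_v` that satisfy the relations up to terms of lower degree. -/
structure IsPoint (G : ∀ i, SimpleGraph (V i)) (t : (∀ i, V i) → ℤ) : Prop where
  isFace : IsFace G (Finset.univ.filter fun v => t v ≠ 0)
  sum_eq : ∀ u, t u ≠ 0 → ∑ v, t v = 1
  sum_filter_eq : ∀ u w i, t u ≠ 0 → t w ≠ 0 → u i ≠ w i →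
    ∑ v : ∀ i, V i with v i = u i, t v =
      if w i < u i then ((i : ℕ) : ℤ) + 2 else 1 - (((i : ℕ) : ℤ) + 2)

theorem isPoint_stageWeight {G : ∀ i, SimpleGraph (V i)} (h : lo ≤ hi)
    (hadj : ∀ i, lo i = hi i ∨ (G i).Adj (lo i) (hi i)) : IsPoint G (stageWeight lo hi π) := by
  have val : ∀ j i, stage lo hi π j i = lo i ∨ stage lo hi π j i = hi i := by
    intro j i
    simp only [stage]
    split_ifs
    · exact Or.inr rfl
    · exact Or.inl rfl
  refine ⟨⟨?_, ?_, ?_⟩, fun _ _ => sum_stageWeight_univ, ?_⟩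
  · intro u hu v hv
    obtain ⟨m, -, rfl⟩ := exists_stage_of_stageWeight_ne_zero (Finset.mem_filter.1 hu).2
    obtain ⟨n, -, rfl⟩ := exists_stage_of_stageWeight_ne_zero (Finset.mem_filter.1 hv).2
    exact (le_total m n).imp (fun h' => stage_mono h h') fun h' => stage_mono h h'
  · intro u hu v hv i
    obtain ⟨m, -, rfl⟩ := exists_stage_of_stageWeight_ne_zero (Finset.mem_filter.1 hu).2
    obtain ⟨n, -, rfl⟩ := exists_stage_of_stageWeight_ne_zero (Finset.mem_filter.1 hv).2
    rcases val m i with e | e <;> rcases val n i with e' | e' <;> rw [e, e']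
    · exact Or.inl rfl
    · exact hadj i
    · exact (hadj i).imp Eq.symm fun h => h.symm
    · exact Or.inl rfl
  · intro u hu v hv w hw i huv hvw
    obtain ⟨m, -, rfl⟩ := exists_stage_of_stageWeight_ne_zero (Finset.mem_filter.1 hu).2
    obtain ⟨n, -, rfl⟩ := exists_stage_of_stageWeight_ne_zero (Finset.mem_filter.1 hv).2
    obtain ⟨k, -, rfl⟩ := exists_stage_of_stageWeight_ne_zero (Finset.mem_filter.1 hw).2
    have := h i
    rcases val m i with e | e <;> rcases val n i with e' | e' <;> rcases val k i with e'' | e'' <;>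
      rw [e, e'] at huv <;> rw [e', e''] at hvw <;> order
  · intro u w i hu hw hne
    obtain ⟨m, -, rfl⟩ := exists_stage_of_stageWeight_ne_zero hu
    obtain ⟨n, -, rfl⟩ := exists_stage_of_stageWeight_ne_zero hw
    rcases val m i with e | e <;> rcases val n i with e' | e' <;> rw [e, e'] at hne <;> rw [e, e']
    · exact (hne rfl).elim
    · rw [if_neg (not_lt.2 (h i)), sum_stageWeight_lo hne]
    · rw [if_pos (lt_of_le_of_ne (h i) hne.symm), sum_stageWeight_hi hne.symm]
    · exact (hne rfl).elim

theorem isPoint_zero (G : ∀ i, SimpleGraph (V i)) : IsPoint G (fun _ => 0) :=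
  ⟨by simpa using ⟨by simp, by simp, by simp⟩, by simp, by simp⟩

open Classical in
/-- Each face is contained in the support of a point with the same inversions and directions. -/
theorem IsFace.exists_isPoint {G : ∀ i, SimpleGraph (V i)} {S : Finset (∀ i, V i)}
    (hS : IsFace G S) (hne : S.Nonempty) : ∃ t, IsPoint G t ∧ (∀ v ∈ S, t v ≠ 0) ∧
      invs (Finset.univ.filter fun v => t v ≠ 0) ⊆ invs S ∧
      dirs (Finset.univ.filter fun v => t v ≠ 0) ⊆ dirs S := by
  obtain ⟨lo, hlo, hmin⟩ := S.exists_minimal hne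
  obtain ⟨hi, hhi, hmax⟩ := S.exists_maximal hne
  have hlo_le : ∀ v ∈ S, lo ≤ v := fun v hv =>
    (hS.total lo hlo v hv).elim id fun h => hmin hv h
  have hle_hi : ∀ v ∈ S, v ≤ hi := fun v hv =>
    (hS.total v hv hi hhi).elim id fun h => hmax hv h
  -- The count `β i` grows with the time at which `S` rises in direction `i`, so sorting by it
  -- refines `S` to a path. Ties are broken by increasing index, so that the refinement creates no
  -- inversion.
  set β : Fin d → ℕ := fun i => (S.filter fun v => v i = lo i).card with hβ
  set key : Fin d → ℕ ×ₗ Fin d := fun i => toLex (β i, i) with hkey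
  set π := Tuple.sort key
  have hmono : Monotone (key ∘ π) := Tuple.monotone_sort key
  have hinj : Function.Injective key := fun i j h => congrArg (fun x => (ofLex x).2) h
  have key_lt : ∀ i l, π.symm i < π.symm l → key i < key l := by
    intro i l h
    have := hmono h.le
    simp only [Function.comp_apply, Equiv.apply_symm_apply] at this
    exact lt_of_le_of_ne this fun e => h.ne (congrArg π.symm (hinj e))
  have stage_lt : ∀ j i, lo i < stage lo hi π j i → (π.symm i : ℕ) < j := by
    intro j i h
    by_contra hc
    simp [stage, hc] at h
  have stage_lt' : ∀ j i, stage lo hi π j i < hi i → ¬ (π.symm i : ℕ) < j := by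
    intro j i h hc
    simp [stage, hc] at h
  have hle := hlo_le hi hhi
  have lo_le : ∀ j, lo ≤ stage lo hi π j := by
    intro j i
    simp only [stage]
    split_ifs
    · exact hle i
    · exact le_rfl
  have le_hi : ∀ j, stage lo hi π j ≤ hi := by
    intro j i
    simp only [stage]
    split_ifs
    · exact le_rfl
    · exact hle i
  refine ⟨stageWeight lo hi π, isPoint_stageWeight hle (hS.adj lo hlo hi hhi), ?_, ?_, ?_⟩
  · intro v hv
    -- `v` is the stage just after the last direction risen at `v`. A direction `i` placed before a
    -- risen `p` has itself risen, since otherwise `β p < β i`.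
    set H := Finset.univ.filter fun i => lo i < v i with hH
    set j := H.sup fun i => (π.symm i : ℕ) + 1 with hj
    have hjd : j ≤ d := Finset.sup_le fun i _ => (π.symm i).2
    have ev : stage lo hi π j = v := by
      funext i
      simp only [stage]
      split_ifs with h
      · obtain ⟨p, hp, hip⟩ := Finset.lt_sup_iff.1 h
        have hpv : lo p < v p := (Finset.mem_filter.1 hp).2
        by_contra hc
        have hvi : v i < hi i := lt_of_le_of_ne (hle_hi v hv i) (Ne.symm hc)
        have hvi' : v i = lo i :=
          ((hlo_le v hv i).eq_or_lt.resolve_right fun h' =>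
            hS.not_three lo hlo v hv hi hhi i h' hvi).symm
        have hpi : p ≠ i := by
          rintro rfl
          exact hpv.ne' hvi'
        have hlt : π.symm i < π.symm p := by
          refine lt_of_le_of_ne (Fin.le_def.2 (Nat.lt_succ_iff.1 hip)) ?_
          exact fun e => hpi (π.symm.injective e).symm
        have hk := key_lt i p hlt
        have hβlt : β p < β i := by
          refine Finset.card_lt_card ((Finset.ssubset_iff_of_subset ?_).2 ⟨v, ?_, ?_⟩)
          · intro y hy
            simp only [Finset.mem_filter] at hy ⊢
            have hyv : y ≤ v := hS.le_of_lt_apply hy.1 hv (i := p) (hy.2 ▸ hpv)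
            exact ⟨hy.1, le_antisymm (hvi' ▸ hyv i) (hlo_le y hy.1 i)⟩
          · simp [hv, hvi']
          · simp [hpv.ne']
        rcases (Prod.Lex.toLex_lt_toLex.1 hk) with h' | h'
        · exact absurd h' (not_lt.2 hβlt.le)
        · exact hβlt.ne' h'.1
      · by_contra hc
        have hp : i ∈ H := by simpa [hH] using lt_of_le_of_ne (hlo_le v hv i) hc
        have := Finset.le_sup (f := fun i => (π.symm i : ℕ) + 1) hp
        exact h (lt_of_lt_of_le (Nat.lt_succ_self _) this)
    rw [← ev]
    exact stageWeight_ne_zero hle hjd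
  · rintro ⟨i, l⟩ hil
    obtain ⟨hlt, v, hv, ⟨a, ha, hav⟩, b, hb, hvb⟩ := mem_invs.1 hil
    obtain ⟨j, -, rfl⟩ := exists_stage_of_stageWeight_ne_zero (Finset.mem_filter.1 hv).2
    obtain ⟨m, -, rfl⟩ := exists_stage_of_stageWeight_ne_zero (Finset.mem_filter.1 ha).2
    obtain ⟨n, -, rfl⟩ := exists_stage_of_stageWeight_ne_zero (Finset.mem_filter.1 hb).2
    have hl := stage_lt j l ((lo_le m l).trans_lt hav)
    have hi' := stage_lt' j i (hvb.trans_le (le_hi n i))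
    have hk := key_lt l i (by rw [Fin.lt_def]; omega)
    -- On the path `l` rises before `i` although `i < l`, so this is not a tie: `S` itself separates
    -- the two directions.
    have hβlt : β l < β i := by
      rcases (Prod.Lex.toLex_lt_toLex.1 hk) with h' | h'
      · exact h'
      · exact absurd h'.2 (not_lt.2 hlt.le)
    obtain ⟨y, hy, hyl⟩ : ∃ y ∈ S.filter (fun v => v i = lo i), y l ≠ lo l := by
      by_contra hc
      push Not at hc
      refine absurd hβlt (not_lt.2 (Finset.card_le_card fun y hy => ?_))
      exact Finset.mem_filter.2 ⟨(Finset.mem_filter.1 hy).1, hc y hy⟩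
    simp only [Finset.mem_filter] at hy
    refine mem_invs.2 ⟨hlt, y, hy.1, ⟨lo, hlo, lt_of_le_of_ne (hlo_le y hy.1 l) hyl.symm⟩, hi, hhi,
      ?_⟩
    rw [hy.2]
    exact (lo_le j i).trans_lt (hvb.trans_le (le_hi n i))
  · intro i hi'
    obtain ⟨a, ha, b, hb, hab⟩ := mem_dirs.1 hi'
    obtain ⟨m, -, rfl⟩ := exists_stage_of_stageWeight_ne_zero (Finset.mem_filter.1 ha).2
    obtain ⟨n, -, rfl⟩ := exists_stage_of_stageWeight_ne_zero (Finset.mem_filter.1 hb).2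
    exact mem_dirs.2 ⟨lo, hlo, hi, hhi, (lo_le m i).trans_lt (hab.trans_le (le_hi n i))⟩

end Points

/-! ### Recovering a basic face from its inversions and directions -/

section Triangularity

variable {d : ℕ} {V : Fin d → Type u} [∀ i, LinearOrder (V i)]
  {G : ∀ i, SimpleGraph (V i)} {S T F : Finset (∀ i, V i)}

/-- A basic face `S` can be recovered from its inversions and directions among the subsets of a
larger face with the same inversions and directions. -/
theorem IsBasic.subset_of_invs_subset (hS : IsBasic G S) (hF : IsFace G F) (hSF : S ⊆ F)
    (hinvF : invs F ⊆ invs S) (hdirF : dirs F ⊆ dirs S) (hTF : T ⊆ F) (hT : T.Nonempty)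
    (hinv : invs S ⊆ invs T) (hdir : dirs S ⊆ dirs T) : S ⊆ T := by
  intro v hv
  by_contra hvT
  have hvF := hSF hv
  have cmp : ∀ x ∈ T, x < v ∨ v < x := by
    intro x hx
    rcases hF.lt_or_eq_or_gt (hTF hx) hvF with h | h | h
    · exact Or.inl h
    · exact (hvT (h ▸ hx)).elim
    · exact Or.inr h
  -- If `v` is first in `S`, nothing in `T` precedes it, because every direction of `F` rises within
  -- `S` and only once. A direction rising from `v` to the first vertex of `T` would then have to
  -- rise again within `T`. The last vertex is symmetric.
  by_cases hpred : ∃ a ∈ S, a < v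
  swap
  · have hle : ∀ x ∈ S, v ≤ x := by
      intro x hx
      rcases hF.lt_or_eq_or_gt (hSF hx) hvF with h | h | h
      · exact (hpred ⟨x, hx, h⟩).elim
      · exact h.ge
      · exact h.le
    have hlt : ∀ x ∈ T, v < x := by
      intro x hx
      refine (cmp x hx).resolve_left fun h => ?_
      obtain ⟨i, hi⟩ := exists_lt_apply h
      obtain ⟨a, ha, b, hb, hab⟩ := mem_dirs.1 (hdirF (mem_dirs.2 ⟨x, hTF hx, v, hvF, hi⟩))
      exact hF.not_three x (hTF hx) a (hSF ha) b (hSF hb) i (hi.trans_le (hle a ha i)) hab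
    obtain ⟨x, hx, hmin⟩ := T.exists_minimal hT
    obtain ⟨i, hi⟩ := exists_lt_apply (hlt x hx)
    obtain ⟨a, ha, b, hb, hab⟩ := mem_dirs.1 (hdir (hdirF (mem_dirs.2 ⟨v, hvF, x, hTF hx, hi⟩)))
    have hxa : x ≤ a := (hF.total x (hTF hx) a (hTF ha)).elim id fun h => hmin ha h
    exact hF.not_three v hvF a (hTF ha) b (hTF hb) i (hi.trans_le (hxa i)) hab
  by_cases hsucc : ∃ b ∈ S, v < b
  swap
  · have hle : ∀ x ∈ S, x ≤ v := by
      intro x hx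
      rcases hF.lt_or_eq_or_gt (hSF hx) hvF with h | h | h
      · exact h.le
      · exact h.le
      · exact (hsucc ⟨x, hx, h⟩).elim
    have hlt : ∀ x ∈ T, x < v := by
      intro x hx
      refine (cmp x hx).resolve_right fun h => ?_
      obtain ⟨i, hi⟩ := exists_lt_apply h
      obtain ⟨a, ha, b, hb, hab⟩ := mem_dirs.1 (hdirF (mem_dirs.2 ⟨v, hvF, x, hTF hx, hi⟩))
      exact hF.not_three a (hSF ha) b (hSF hb) x (hTF hx) i hab ((hle b hb i).trans_lt hi)
    obtain ⟨x, hx, hmax⟩ := T.exists_maximal hT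
    obtain ⟨i, hi⟩ := exists_lt_apply (hlt x hx)
    obtain ⟨a, ha, b, hb, hab⟩ := mem_dirs.1 (hdir (hdirF (mem_dirs.2 ⟨x, hTF hx, v, hvF, hi⟩)))
    have hbx : b ≤ x := (hF.total b (hTF hb) x (hTF hx)).elim id fun h => hmax hb h
    exact hF.not_three a (hTF ha) b (hTF hb) v hvF i hab ((hbx i).trans_lt hi)
  obtain ⟨i₀, l₀, hil₀, ⟨a₀, ha₀, hav₀⟩, ⟨b₀, hb₀, hvb₀⟩, huniq⟩ := hS.descent v hv hpred hsucc
  obtain ⟨a, ha, hav, hmax⟩ := hS.isFace.exists_pred hpred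
  obtain ⟨b, hb, hvb, hmin⟩ := hS.isFace.exists_succ hsucc
  have haF := hSF ha
  have hbF := hSF hb
  have hl₀ : a l₀ < v l₀ := by
    refine lt_of_le_of_ne (hav.le l₀) fun e => hav.ne (huniq a ha e ?_)
    exact hS.isFace.eq_of_le_of_lt hv hb₀ ha (hav.le i₀) hvb₀
  have hi₀ : v i₀ < b i₀ := by
    refine lt_of_le_of_ne (hvb.le i₀) fun e => hvb.ne' (huniq b hb ?_ e.symm)
    exact hS.isFace.eq_of_lt_of_le ha₀ hv hb hav₀ (hvb.le l₀)
  -- The extremal pair still satisfies `i < l` because `v` is a descent. The inversion `(i, l)` must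
  -- occur in `T`, at some `x` that agrees with `v` at `i` and `l`.
  obtain ⟨l, hl, hl_max⟩ := (Finset.univ.filter fun i => a i < v i).exists_max_image id
    ⟨l₀, by simpa using hl₀⟩
  obtain ⟨i, hi, hi_min⟩ := (Finset.univ.filter fun l => v l < b l).exists_min_image id
    ⟨i₀, by simpa using hi₀⟩
  simp only [Finset.mem_filter, Finset.mem_univ, true_and, id] at hi hi_min hl hl_max
  have hil : i < l := (hi_min _ hi₀).trans_lt (hil₀.trans_le (hl_max _ hl₀))
  have hgap : ∀ y ∈ S, y ≤ a ∨ v ≤ y := by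
    intro y hy
    rcases hS.isFace.lt_or_eq_or_gt hy hv with h | h | h
    · exact Or.inl (hmax y hy h)
    · exact Or.inr h.ge
    · exact Or.inr h.le
  have hgap' : ∀ y ∈ S, y ≤ v ∨ b ≤ y := by
    intro y hy
    rcases hS.isFace.lt_or_eq_or_gt hy hv with h | h | h
    · exact Or.inl h.le
    · exact Or.inl h.le
    · exact Or.inr (hmin y hy h)
  obtain ⟨-, x, hx, ⟨c, hc, hcx⟩, c', hc', hxc'⟩ :=
    mem_invs.1 (hinv (mem_invs.2 ⟨hil, v, hv, ⟨a, ha, hl⟩, b, hb, hi⟩))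
  have hxF := hTF hx
  have hxl : x l = v l := hF.eq_of_lt_of_ne haF hvF hxF hl fun e =>
    hF.not_three c (hTF hc) x hxF v hvF l hcx (e ▸ hl)
  have hxi : x i = v i := by
    by_contra hne
    have := hF.eq_of_lt_of_ne hvF hbF hxF hi hne
    exact hF.not_three v hvF x hxF c' (hTF hc') i (this ▸ hi) hxc'
  -- If `x < v`, a direction `q` still rising up to `v` satisfies `q < l` and gives an inversion
  -- `(q, l)` of `F`. It is not one of `S`, where `q` and `l` rise in the same step from `a` to `v`.
  -- The case `v < x` is the mirror image.
  rcases cmp x hx with h | h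
  · obtain ⟨q, hq⟩ := exists_lt_apply h
    have hax : a ≤ x := hF.le_of_lt_apply haF hxF (hxl ▸ hl)
    have haq : a q < v q := (hax q).trans_lt hq
    have hql : q < l := lt_of_le_of_ne (hl_max q haq) fun e => by
      subst e
      exact hq.ne hxl
    obtain ⟨-, y, hy, ⟨e, he, hey⟩, f, hf, hyf⟩ :=
      mem_invs.1 (hinvF (mem_invs.2 ⟨hql, x, hxF, ⟨a, haF, hxl ▸ hl⟩, v, hvF, hq⟩))
    rcases hgap y hy with h' | h'
    · exact hS.isFace.not_three e he y hy v hv l hey ((h' l).trans_lt hl)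
    · exact hS.isFace.not_three a ha y hy f hf q (haq.trans_le (h' q)) hyf
  · obtain ⟨q, hq⟩ := exists_lt_apply h
    have hxb : x ≤ b := hF.le_of_lt_apply hxF hbF (hxi ▸ hi)
    have hqb : v q < b q := hq.trans_le (hxb q)
    have hiq : i < q := lt_of_le_of_ne (hi_min q hqb) fun e => by
      subst e
      exact hq.ne' hxi
    obtain ⟨-, y, hy, ⟨e, he, hey⟩, f, hf, hyf⟩ :=
      mem_invs.1 (hinvF (mem_invs.2 ⟨hiq, x, hxF, ⟨v, hvF, hq⟩, b, hbF, hxi ▸ hi⟩))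
    rcases hgap' y hy with h' | h'
    · exact hS.isFace.not_three e he y hy b hb q hey ((h' q).trans_lt hqb)
    · exact hS.isFace.not_three v hv y hy f hf i (hi.trans_le (h' i)) hyf

theorem IsBasic.eq_of_invs_eq (hS : IsBasic G S) (hT : IsBasic G T) (hF : IsFace G F)
    (hSF : S ⊆ F) (hinvF : invs F ⊆ invs S) (hdirF : dirs F ⊆ dirs S) (hTF : T ⊆ F)
    (hSne : S.Nonempty) (hTne : T.Nonempty) (hinv : invs S = invs T) (hdir : dirs S = dirs T) :
    T = S :=
  Finset.Subset.antisymm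
    (hT.subset_of_invs_subset hF hTF (hinv ▸ hinvF) (hdir ▸ hdirF) hSF hSne hinv.ge hdir.ge)
    (hS.subset_of_invs_subset hF hSF hinvF hdirF hTF hTne hinv.le hdir.le)

variable [∀ i, Fintype (V i)]

/-- A numerical invariant of faces for which the evaluation of the basic monomials at suitable
points is triangular. -/
noncomputable def rank (S : Finset (∀ i, V i)) : ℕ :=
  -- The last term separates the empty face from single vertices, which have neither inversions nor
  -- directions.
  (invs S).card + (dirs S).card + min 1 S.card

theorem IsBasic.exists_isPoint (hS : IsBasic G S) : ∃ t, IsPoint G t ∧ (∀ v ∈ S, t v ≠ 0) ∧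
    ∀ T, IsBasic G T → (∀ v ∈ T, t v ≠ 0) → T ≠ S → rank T < rank S := by
  classical
  rcases S.eq_empty_or_nonempty with rfl | hSne
  · refine ⟨fun _ => 0, isPoint_zero G, by simp, fun T _ hT hne => ?_⟩
    obtain ⟨v, hv⟩ := Finset.nonempty_iff_ne_empty.2 hne
    exact (hT v hv rfl).elim
  obtain ⟨t, ht, hSt, hinv, hdir⟩ := hS.isFace.exists_isPoint hSne
  refine ⟨t, ht, hSt, fun T hT hTt hne => ?_⟩
  set F := Finset.univ.filter fun v => t v ≠ 0
  have hSF : S ⊆ F := fun v hv => Finset.mem_filter.2 ⟨Finset.mem_univ _, hSt v hv⟩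
  have hTF : T ⊆ F := fun v hv => Finset.mem_filter.2 ⟨Finset.mem_univ _, hTt v hv⟩
  have i1 : invs T ⊆ invs S := (invs_mono hTF).trans hinv
  have i2 : dirs T ⊆ dirs S := (dirs_mono hTF).trans hdir
  have c1 := Finset.card_le_card i1
  have c2 := Finset.card_le_card i2
  have c3 : 0 < S.card := Finset.card_pos.2 hSne
  by_contra hc
  simp only [rank] at hc
  have hTne : T.Nonempty := Finset.card_pos.1 (by omega)
  exact hne (hS.eq_of_invs_eq hT ht.isFace hSF hinv hdir hTF hSne hTne
    (Finset.eq_of_subset_of_card_le i1 (by omega)).symm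
    (Finset.eq_of_subset_of_card_le i2 (by omega)).symm)

end Triangularity

/-! ### Linear independence by evaluation and degree -/

section Independence

variable {d : ℕ} {V : Fin d → Type u} [∀ i, LinearOrder (V i)] [∀ i, Fintype (V i)]
  (G : ∀ i, SimpleGraph (V i))

/-- The basic faces, which index a basis of the Chow ring. -/
abbrev BasicFace : Type u := {S : Finset (∀ i, V i) // IsBasic G S}

/-- A point adapted to a basic face. -/
noncomputable def point (S : BasicFace G) : (∀ i, V i) → ℤ := S.2.exists_isPoint.choose

theorem isPoint_point (S : BasicFace G) : IsPoint G (point G S) :=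
  S.2.exists_isPoint.choose_spec.1

/-- The evaluation of polynomials at the points adapted to the basic faces. -/
noncomputable def evalPoints : MvPolynomial (∀ i, V i) ℤ →+* (BasicFace G → ℤ) :=
  RingHom.pi fun S => (aeval (point G S)).toRingHom

theorem evalPoints_X (v : ∀ i, V i) (S : BasicFace G) : evalPoints G (X v) S = point G S v := by
  simp [evalPoints]

theorem evalPoints_mon (s : Multiset (∀ i, V i)) (S : BasicFace G) :
    evalPoints G (mon s) S = (s.map (point G S)).prod := by
  induction s using Multiset.induction_on with
  | empty => simp [mon_zero]
  | cons a s ih => rw [mon_cons, map_mul, Pi.mul_apply, evalPoints_X, ih]; simp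

theorem evalPoints_mon_ne_zero {s : Multiset (∀ i, V i)} {S : BasicFace G} :
    evalPoints G (mon s) S ≠ 0 ↔ ∀ v ∈ s, point G S v ≠ 0 := by
  rw [evalPoints_mon, Ne, Multiset.prod_eq_zero_iff]
  simp [not_exists]

theorem evalPoints_mon_of_not_isFace {s : Multiset (∀ i, V i)} (h : ¬ IsFace G s.toFinset) :
    evalPoints G (mon s) = 0 := by
  funext S
  by_contra hne
  refine h ((isPoint_point G S).isFace.subset fun v hv => ?_)
  simpa using (evalPoints_mon_ne_zero G).1 hne v (Multiset.mem_toFinset.1 hv)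

theorem evalPoints_mon_mul_sum {s : Multiset (∀ i, V i)} (hs : s ≠ 0) :
    evalPoints G (mon s * ∑ v, X v) = evalPoints G (mon s) := by
  funext S
  rw [map_mul, map_sum, Pi.mul_apply, Finset.sum_apply]
  simp only [evalPoints_X]
  by_cases h : evalPoints G (mon s) S = 0
  · rw [h, zero_mul]
  · obtain ⟨u, hu⟩ := Multiset.exists_mem_of_ne_zero hs
    rw [(isPoint_point G S).sum_eq u ((evalPoints_mon_ne_zero G).1 h u hu), mul_one]

theorem evalPoints_mon_mul_sum_filter {s : Multiset (∀ i, V i)} {u w : ∀ i, V i} {i : Fin d}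
    (hu : u ∈ s) (hw : w ∈ s) (h : u i ≠ w i) : ∃ c : ℤ,
    evalPoints G (mon s * ∑ v : ∀ i, V i with v i = u i, X v) = c • evalPoints G (mon s) := by
  refine ⟨if w i < u i then ((i : ℕ) : ℤ) + 2 else 1 - (((i : ℕ) : ℤ) + 2), ?_⟩
  funext S
  rw [map_mul, map_sum, Pi.mul_apply, Finset.sum_apply, Pi.smul_apply]
  simp only [evalPoints_X]
  by_cases h0 : evalPoints G (mon s) S = 0
  · rw [h0, zero_mul, smul_zero]
  · have ht := (evalPoints_mon_ne_zero G).1 h0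
    rw [(isPoint_point G S).sum_filter_eq u w i (ht u hu) (ht w hw) h, mul_comm, smul_eq_mul]

/-- In a nontrivial relation, take a face `S` of minimal rank with nonzero coefficient and evaluate
at its point: any other basic monomial not vanishing there has smaller rank. -/
theorem linearIndependent_evalPoints :
    LinearIndependent ℤ fun S : BasicFace G => evalPoints G (mon S.1.val) := by
  classical
  rw [Fintype.linearIndependent_iff]
  intro c hc
  by_contra hne
  push Not at hne
  obtain ⟨S, hS, hmin⟩ := (Finset.univ.filter fun S => c S ≠ 0).exists_min_image
    (fun S : BasicFace G => rank S.1) (by obtain ⟨S, hS⟩ := hne; exact ⟨S, by simpa using hS⟩)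
  simp only [Finset.mem_filter, Finset.mem_univ, true_and] at hS hmin
  have spec := S.2.exists_isPoint.choose_spec
  have h := congrFun hc S
  rw [Finset.sum_apply, Finset.sum_eq_single S] at h
  · simp only [Pi.smul_apply, smul_eq_mul, Pi.zero_apply, mul_eq_zero] at h
    exact h.elim hS ((evalPoints_mon_ne_zero G).2 spec.2.1)
  · intro T _ hTS
    by_contra h0
    simp only [Pi.smul_apply, smul_eq_mul, mul_eq_zero, not_or] at h0
    refine absurd (hmin T h0.1) (not_le.2 (spec.2.2 T.1 T.2 ?_ fun e => hTS (Subtype.ext e)))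
    exact (evalPoints_mon_ne_zero G).1 h0.2
  · simp

/-- The span of the values of the basic monomials of degree less than `k`. -/
noncomputable def lowSpan (k : ℕ) : Submodule ℤ (BasicFace G → ℤ) :=
  Submodule.span ℤ ((fun S : BasicFace G => evalPoints G (mon S.1.val)) '' {S | S.1.card < k})

theorem lowSpan_mono {k l : ℕ} (h : k ≤ l) : lowSpan G k ≤ lowSpan G l :=
  Submodule.span_mono (Set.image_mono fun _ hS => lt_of_lt_of_le hS h)

/-- Straightening works on values too: at the points, each linear form of the relations acts on the
monomial as a constant. The error is thus a multiple of a monomial of degree one less, treated by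
induction. -/
theorem evalPoints_mon_mem_lowSpan (s : Multiset (∀ i, V i)) :
    evalPoints G (mon s) ∈ lowSpan G (s.card + 1) := by
  induction hk : s.card using Nat.strong_induction_on generalizing s with
  | _ k ih =>
  have hN : Straightens G k
      ((lowSpan G (k + 1)).toAddSubgroup.comap (evalPoints G).toAddMonoidHom) := by
    refine ⟨fun t _ hf => ?_, fun S hS hb => ?_, fun t ht hne => ?_, fun t u w i ht hu hw h => ?_⟩
    · change evalPoints G (mon t) ∈ lowSpan G (k + 1)
      rw [evalPoints_mon_of_not_isFace G hf]
      exact zero_mem _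
    · exact Submodule.subset_span ⟨⟨S, hb⟩, by simp [hS], rfl⟩
    · change evalPoints G (mon t * ∑ v, X v) ∈ lowSpan G (k + 1)
      rw [evalPoints_mon_mul_sum G hne]
      exact lowSpan_mono G (by omega) (ih _ (by omega) t rfl)
    · change evalPoints G (mon t * ∑ v : ∀ i, V i with v i = u i, X v) ∈ lowSpan G (k + 1)
      obtain ⟨c, hc⟩ := evalPoints_mon_mul_sum_filter G hu hw h
      rw [hc]
      exact Submodule.smul_mem _ _ (lowSpan_mono G (by omega) (ih _ (by omega) t rfl))
  exact hN.mon_mem s hk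

/-- `N` is only an additive subgroup, hence the test on all monomial multiples of the relations. -/
theorem mem_of_mem_Irat {N : AddSubgroup (MvPolynomial (∀ i, V i) ℤ)}
    (hN : ∀ s r, IsRelation G r → mon s * r ∈ N) {p : MvPolynomial (∀ i, V i) ℤ}
    (hp : p ∈ Irat G) : p ∈ N := by
  suffices ∀ s, mon s * p ∈ N by simpa [mon_zero] using this 0
  induction hp using Submodule.span_induction with
  | mem r hr => exact fun s => hN s r hr
  | zero => intro s; simp
  | add x y _ _ hx hy => intro s; rw [mul_add]; exact N.add_mem (hx s) (hy s)
  | smul a x _ hx =>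
    intro s
    have := mem_of_forall_mon (N := N.comap (AddMonoidHom.mulRight (mon s * x)))
      (fun t => by
        change mon t * (mon s * x) ∈ N
        rw [← mul_assoc, ← mon_add]
        exact hx _) a
    change a * (mon s * x) ∈ N at this
    rwa [smul_eq_mul, mul_left_comm]

/-- Monomial multiples of relations are homogeneous. Those of type 1 vanish at all points; in the
other types the linear factor evaluates to a constant, and the degree drops by one. -/
theorem evalPoints_homogeneousComponent_mem {p : MvPolynomial (∀ i, V i) ℤ} (hp : p ∈ Irat G)
    (k : ℕ) : evalPoints G (homogeneousComponent k p) ∈ lowSpan G k := by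
  refine mem_of_mem_Irat G (N := ((lowSpan G k).toAddSubgroup.comap
    (evalPoints G).toAddMonoidHom).comap (homogeneousComponent k).toAddMonoidHom) ?_ hp
  intro s r hr
  change evalPoints G (homogeneousComponent k (mon s * r)) ∈ lowSpan G k
  have key : ∀ n (q : MvPolynomial (∀ i, V i) ℤ), q.IsHomogeneous n →
      (k = n → evalPoints G q ∈ lowSpan G k) →
      evalPoints G (homogeneousComponent k q) ∈ lowSpan G k := by
    intro n q hn h
    rw [homogeneousComponent_of_mem hn]
    split_ifs with hk
    · exact h hk
    · simp
  have hsum : ∀ T : Finset (∀ i, V i), (∑ v ∈ T, X v : MvPolynomial (∀ i, V i) ℤ).IsHomogeneous 1 :=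
    fun T => IsHomogeneous.sum _ _ _ fun v _ => isHomogeneous_X ℤ v
  rcases hr with ⟨n, v, hv⟩ | ⟨u⟩ | ⟨u, w, i, h⟩
  · have e : (∏ j, X (v j) : MvPolynomial (∀ i, V i) ℤ) = mon (Finset.univ.val.map v) := by
      rw [mon, Multiset.map_map]
      rfl
    rw [e, ← mon_add]
    refine key _ _ (isHomogeneous_mon _) fun _ => ?_
    rw [evalPoints_mon_of_not_isFace]
    · exact zero_mem _
    · intro hf
      rw [formsSimplex_iff_isFace] at hv
      refine hv (hf.subset fun x hx => ?_)
      simp only [Finset.mem_image, Finset.mem_univ, true_and] at hx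
      obtain ⟨j, rfl⟩ := hx
      rw [Multiset.mem_toFinset, Multiset.mem_add]
      exact Or.inr (Multiset.mem_map_of_mem v (Finset.mem_univ_val j))
  · rw [← mul_assoc, mul_comm (mon s), ← mon_cons]
    refine key _ _ ((isHomogeneous_mon _).mul (hsum _)) fun hk => ?_
    rw [evalPoints_mon_mul_sum G (Multiset.cons_ne_zero), hk]
    exact evalPoints_mon_mem_lowSpan G _
  · rw [← mul_assoc, mul_comm (mon s), mul_assoc (X u), ← mon_cons, ← mon_cons]
    refine key _ _ ((isHomogeneous_mon _).mul (hsum _)) fun hk => ?_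
    obtain ⟨c, hc⟩ := evalPoints_mon_mul_sum_filter G (s := u ::ₘ w ::ₘ s) (by simp) (by simp) h
    rw [hc, hk]
    exact Submodule.smul_mem _ _ (evalPoints_mon_mem_lowSpan G _)

/-- The class in the Chow ring of the monomial of a basic face. -/
noncomputable def basicClass (S : BasicFace G) : Chow G := chowMk G (mon S.1.val)

/-- If a combination lies in the ideal, the value of its degree `k` part lies in the span of the
degree `k` values and in that of the lower ones. These spans meet in zero, and the degree `k` values
are independent. -/
theorem linearIndependent_basicClass : LinearIndependent ℤ (basicClass G) := by
  classical
  rw [Fintype.linearIndependent_iff]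
  intro c hc S
  set p : MvPolynomial (∀ i, V i) ℤ := ∑ T : BasicFace G, c T • mon T.1.val with hp
  have hpI : p ∈ Irat G := by
    refine Ideal.Quotient.eq_zero_iff_mem.1 ?_
    change chowMk G p = 0
    rw [hp, map_sum, ← hc]
    exact Finset.sum_congr rfl fun T _ => map_zsmul _ _ _
  set k := S.1.card with hk
  have hlow := evalPoints_homogeneousComponent_mem G hpI k
  have e : evalPoints G (homogeneousComponent k p) =
      ∑ T : BasicFace G, (if T.1.card = k then c T else 0) • evalPoints G (mon T.1.val) := by
    rw [hp, map_sum, map_sum]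
    refine Finset.sum_congr rfl fun T _ => ?_
    rw [map_zsmul, homogeneousComponent_of_mem (isHomogeneous_mon T.1.val), map_zsmul]
    change c T • evalPoints G (if k = T.1.card then _ else _) = _
    by_cases h : T.1.card = k
    · rw [if_pos h.symm, if_pos h]
    · rw [if_neg (Ne.symm h), if_neg h, map_zero, smul_zero, zero_smul]
  have htop : evalPoints G (homogeneousComponent k p) ∈ Submodule.span ℤ
      ((fun S : BasicFace G => evalPoints G (mon S.1.val)) '' {S | S.1.card = k}) := by
    rw [e]
    refine Submodule.sum_mem _ fun T _ => ?_
    split_ifs with h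
    · exact Submodule.smul_mem _ _ (Submodule.subset_span ⟨T, h, rfl⟩)
    · simp
  have h0 := Submodule.disjoint_def.1 ((linearIndependent_evalPoints G).disjoint_span_image
    (s := {S | S.1.card = k}) (t := {S | S.1.card < k})
    (Set.disjoint_left.2 fun T (h : T.1.card = k) (h' : T.1.card < k) => h'.ne h)) _ htop hlow
  rw [e] at h0
  have := Fintype.linearIndependent_iff.1 (linearIndependent_evalPoints G) _ h0 S
  rwa [if_pos hk.symm] at this

/-! ### The monomial basis and the grading -/

theorem mon_mem_Irat {s : Multiset (∀ i, V i)} (h : ¬ IsFace G s.toFinset) : mon s ∈ Irat G := by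
  induction s using Quot.inductionOn with
  | h l =>
  rcases l with _ | ⟨a, l⟩
  · exact (h ⟨by simp, by simp, by simp⟩).elim
  · have e : mon (Quot.mk _ (a :: l) : Multiset (∀ i, V i)) =
        ∏ j : Fin (l.length + 1), X ((a :: l).get j) := by
      rw [← List.prod_ofFn]
      change (Multiset.map X (↑(a :: l) : Multiset (∀ i, V i))).prod = _
      rw [Multiset.map_coe, Multiset.prod_coe]
      congr 1
      conv_lhs => rw [← List.ofFn_get (a :: l)]
      rw [List.map_ofFn]
      rfl
    rw [e]
    refine Ideal.subset_span (.r1 _ _ fun hs => h ?_)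
    rw [formsSimplex_iff_isFace] at hs
    refine hs.subset fun x hx => ?_
    have hx : x ∈ a :: l := Multiset.mem_toFinset.1 hx
    obtain ⟨j, hj⟩ := List.get_of_mem hx
    exact Finset.mem_image.2 ⟨j, Finset.mem_univ _, hj⟩

/-- Straightening modulo the ideal itself preserves the degree, so the basis is compatible with the
grading. -/
theorem chowMk_mon_mem_span (s : Multiset (∀ i, V i)) : chowMk G (mon s) ∈
    Submodule.span ℤ (basicClass G '' {S | S.1.card = s.card}) := by
  set W := Submodule.span ℤ (basicClass G '' {S | S.1.card = s.card})
  have zero : ∀ p ∈ Irat G, chowMk G p ∈ W := fun p hp => by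
    have : chowMk G p = 0 := Ideal.Quotient.eq_zero_iff_mem.2 hp
    rw [this]
    exact zero_mem _
  have hN : Straightens G s.card (W.toAddSubgroup.comap (chowMk G).toAddMonoidHom) := by
    refine ⟨fun t _ hf => zero _ (mon_mem_Irat G hf), fun S hS hb => ?_, fun t _ hne => ?_,
      fun t u w i _ hu hw h => ?_⟩
    · exact Submodule.subset_span ⟨⟨S, hb⟩, hS, rfl⟩
    · obtain ⟨u, hu⟩ := Multiset.exists_mem_of_ne_zero hne
      obtain ⟨t, rfl⟩ := Multiset.exists_cons_of_mem hu
      refine zero _ ?_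
      rw [mon_cons, mul_comm (X u), mul_assoc]
      exact Ideal.mul_mem_left _ _ (Ideal.subset_span (.r2 u))
    · obtain ⟨t, rfl⟩ := Multiset.exists_cons_of_mem hu
      have hw' : w ∈ t := (Multiset.mem_cons.1 hw).resolve_left fun e => h (e ▸ rfl)
      obtain ⟨t, rfl⟩ := Multiset.exists_cons_of_mem hw'
      refine zero _ ?_
      rw [mon_cons, mon_cons, ← mul_assoc, mul_comm _ (mon t), mul_assoc]
      exact Ideal.mul_mem_left _ _ (Ideal.subset_span (.r3 u w i h))
  exact hN.mon_mem s rfl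

theorem span_basicClass : Submodule.span ℤ (Set.range (basicClass G)) = ⊤ := by
  refine eq_top_iff.2 fun x _ => ?_
  obtain ⟨p, rfl⟩ := Ideal.Quotient.mk_surjective x
  exact mem_of_forall_mon (N := (Submodule.span ℤ (Set.range (basicClass G))).toAddSubgroup.comap
    (chowMk G).toAddMonoidHom) (fun s => Submodule.span_mono (Set.image_subset_range _ _)
      (chowMk_mon_mem_span G s)) p

/-- The basis of the Chow ring given by the monomials of the basic faces. -/
noncomputable def chowBasis : Module.Basis (BasicFace G) ℤ (Chow G) :=
  Module.Basis.mk (linearIndependent_basicClass G) (span_basicClass G).ge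

theorem chowBasis_apply (S : BasicFace G) : chowBasis G S = chowMk G (mon S.1.val) := by
  rw [chowBasis, Module.Basis.mk_apply, basicClass]

/-- The graded pieces are spanned by the basis elements of the given degree. -/
theorem mem_chowDeg_iff {k : ℕ} {x : Chow G} :
    x ∈ chowDeg G k ↔ ∀ S : BasicFace G, S.1.card ≠ k → (chowBasis G).repr x S = 0 := by
  have hb : (chowBasis G : BasicFace G → Chow G) = basicClass G :=
    funext fun S => chowBasis_apply G S
  constructor
  · rintro ⟨p, hp, rfl⟩ S hS
    have hmem : chowMk G p ∈ Submodule.span ℤ (basicClass G '' {S | S.1.card = k}) :=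
      mem_of_isHomogeneous (k := k) (N := (Submodule.span ℤ
        (basicClass G '' {S | S.1.card = k})).toAddSubgroup.comap (chowMk G).toAddMonoidHom)
        (fun s hs => by
          subst hs
          exact chowMk_mon_mem_span G s) hp
    rw [← hb, (chowBasis G).mem_span_image] at hmem
    by_contra hne
    exact hS (hmem (Finsupp.mem_support_iff.2 hne))
  · intro h
    rw [← (chowBasis G).linearCombination_repr x, Finsupp.linearCombination_apply, Finsupp.sum]
    refine AddSubgroup.sum_mem _ fun S hS => AddSubgroup.zsmul_mem _ ?_ _
    have hk : S.1.card = k := by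
      by_contra hne
      exact Finsupp.mem_support_iff.1 hS (h S hne)
    rw [chowBasis_apply]
    exact ⟨mon S.1.val, hk ▸ isHomogeneous_mon S.1.val, rfl⟩

end Independence

/-! ### Restriction in terms of basis coefficients -/

section Restriction

theorem polyPull_mon_eq_zero {d : ℕ} {V : Fin d → Type u} [∀ i, LinearOrder (V i)]
    {W : Fin d → Type v} [∀ i, Fintype (W i)] {f : ∀ i, W i → V i}
    {s : Multiset (∀ i, V i)} {v : ∀ i, V i} (hv : v ∈ s) (h : ∀ u, vmap f u ≠ v) : polyPull f (mon s) = 0 := by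
  obtain ⟨s, rfl⟩ := Multiset.exists_cons_of_mem hv
  rw [mon_cons, map_mul, polyPull, aeval_X, Finset.sum_eq_zero, zero_mul]
  intro u hu
  exact (h u (Finset.mem_filter.1 hu).2).elim

variable {d : ℕ} {V : Fin d → Type u} [∀ i, LinearOrder (V i)]
  {W : Fin d → Type v} [∀ i, LinearOrder (W i)]

/-- The map induced on vertices by strictly monotone maps, as an embedding. -/
def vmapEmb {f : ∀ i, W i → V i} (hs : ∀ i, StrictMono (f i)) : (∀ i, W i) ↪ (∀ i, V i) :=
  ⟨vmap f, fun _ _ h => funext fun i => (hs i).injective (congrFun h i)⟩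

theorem isFace_map {H : ∀ i, SimpleGraph (W i)} {G : ∀ i, SimpleGraph (V i)}
    {f : ∀ i, W i → V i} (hs : ∀ i, StrictMono (f i))
    (ha : ∀ i a b, (G i).Adj (f i a) (f i b) ↔ (H i).Adj a b) {S : Finset (∀ i, W i)} :
    IsFace G (S.map (vmapEmb hs)) ↔ IsFace H S := by
  have le : ∀ a b : ∀ i, W i, vmap f a ≤ vmap f b ↔ a ≤ b := fun a b =>
    forall_congr' fun i => (hs i).le_iff_le
  constructor
  · rintro ⟨h1, h2, h3⟩
    simp only [Finset.forall_mem_map] at h1 h2 h3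
    exact ⟨fun u hu v hv => (h1 u hu v hv).imp (le _ _).1 (le _ _).1,
      fun u hu v hv i => (h2 u hu v hv i).imp (fun e => (hs i).injective e) (ha i _ _).1,
      fun u hu v hv w hw i huv hvw => h3 u hu v hv w hw i (hs i huv) (hs i hvw)⟩
  · rintro ⟨h1, h2, h3⟩
    refine ⟨?_, ?_, ?_⟩ <;> simp only [Finset.forall_mem_map]
    · exact fun u hu v hv => (h1 u hu v hv).imp (le _ _).2 (le _ _).2
    · exact fun u hu v hv i => (h2 u hu v hv i).imp (congrArg (f i)) (ha i _ _).2
    · exact fun u hu v hv w hw i huv hvw =>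
        h3 u hu v hv w hw i ((hs i).lt_iff_lt.1 huv) ((hs i).lt_iff_lt.1 hvw)

/-- The condition involves only comparisons and adjacencies between coordinates of vertices of the
face, never the ambient product. This is what makes the bases compatible. -/
theorem isBasic_map {H : ∀ i, SimpleGraph (W i)} {G : ∀ i, SimpleGraph (V i)}
    {f : ∀ i, W i → V i} (hs : ∀ i, StrictMono (f i))
    (ha : ∀ i a b, (G i).Adj (f i a) (f i b) ↔ (H i).Adj a b) {S : Finset (∀ i, W i)} :
    IsBasic G (S.map (vmapEmb hs)) ↔ IsBasic H S := by
  have le : ∀ a b : ∀ i, W i, vmapEmb hs a ≤ vmapEmb hs b ↔ a ≤ b := fun a b =>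
    forall_congr' fun i => (hs i).le_iff_le
  have lt : ∀ a b : ∀ i, W i, vmapEmb hs a < vmapEmb hs b ↔ a < b := fun a b => by
    rw [lt_iff_le_not_ge, lt_iff_le_not_ge, le, le]
  have lti : ∀ (a b : ∀ i, W i) i, vmapEmb hs a i < vmapEmb hs b i ↔ a i < b i := fun a b i =>
    (hs i).lt_iff_lt
  have eqi : ∀ (a b : ∀ i, W i) i, vmapEmb hs a i = vmapEmb hs b i ↔ a i = b i := fun a b i =>
    (hs i).injective.eq_iff
  have key : (∀ v ∈ S.map (vmapEmb hs), (∃ a ∈ S.map (vmapEmb hs), a < v) →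
      (∃ b ∈ S.map (vmapEmb hs), v < b) → ∃ i l, i < l ∧ (∃ a ∈ S.map (vmapEmb hs), a l < v l) ∧
        (∃ b ∈ S.map (vmapEmb hs), v i < b i) ∧
        ∀ w ∈ S.map (vmapEmb hs), w l = v l → w i = v i → w = v) ↔
      ∀ v ∈ S, (∃ a ∈ S, a < v) → (∃ b ∈ S, v < b) →
      ∃ i l, i < l ∧ (∃ a ∈ S, a l < v l) ∧ (∃ b ∈ S, v i < b i) ∧
        ∀ w ∈ S, w l = v l → w i = v i → w = v := by
    simp only [Finset.forall_mem_map]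
    simp only [Finset.mem_map, exists_exists_and_eq_and, lt, lti, eqi,
      (vmapEmb hs).injective.eq_iff]
  exact ⟨fun h => ⟨(isFace_map hs ha).1 h.1, key.1 h.2⟩,
    fun h => ⟨(isFace_map hs ha).2 h.1, key.2 h.2⟩⟩

variable [∀ i, Fintype (W i)]

theorem polyPull_mon_map {f : ∀ i, W i → V i} (hs : ∀ i, StrictMono (f i))
    (s : Multiset (∀ i, W i)) : polyPull f (mon (s.map (vmapEmb hs))) = mon s := by
  induction s using Multiset.induction_on with
  | empty => simp [mon_zero]
  | cons a s ih =>
    rw [Multiset.map_cons, mon_cons, mon_cons, map_mul, ih, polyPull, aeval_X]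
    congr 1
    rw [Finset.sum_eq_single a]
    · intro b hb hne
      exact (hne ((vmapEmb hs).injective (Finset.mem_filter.1 hb).2)).elim
    · intro h
      exact (h (Finset.mem_filter.2 ⟨Finset.mem_univ _, rfl⟩)).elim

variable [∀ i, Fintype (V i)]

open Classical in
/-- The coefficients of an element of the Chow ring with respect to the basis given by the basic
faces, extended by zero. -/
noncomputable def coef (G : ∀ i, SimpleGraph (V i)) (x : Chow G) (S : Finset (∀ i, V i)) : ℤ :=
  if h : IsBasic G S then (chowBasis G).repr x ⟨S, h⟩ else 0

theorem coef_of_isBasic {G : ∀ i, SimpleGraph (V i)} (x : Chow G) {S : Finset (∀ i, V i)}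
    (h : IsBasic G S) : coef G x S = (chowBasis G).repr x ⟨S, h⟩ := dif_pos h

theorem eq_of_coef_eq {G : ∀ i, SimpleGraph (V i)} {x y : Chow G}
    (h : ∀ S, IsBasic G S → coef G x S = coef G y S) : x = y := by
  refine (chowBasis G).repr.injective (Finsupp.ext fun S => ?_)
  rw [← coef_of_isBasic x S.2, ← coef_of_isBasic y S.2, h S.1 S.2]

theorem exists_coef_eq (G : ∀ i, SimpleGraph (V i)) (c : Finset (∀ i, V i) → ℤ) :
    ∃ x : Chow G, ∀ S, IsBasic G S → coef G x S = c S := by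
  classical
  refine ⟨(chowBasis G).equivFun.symm fun S => c S.1, fun S hS => ?_⟩
  rw [coef_of_isBasic _ hS, ← Module.Basis.equivFun_apply, LinearEquiv.apply_symm_apply]

theorem mem_chowDeg_iff_coef {G : ∀ i, SimpleGraph (V i)} {k : ℕ} {x : Chow G} :
    x ∈ chowDeg G k ↔ ∀ S, IsBasic G S → S.card ≠ k → coef G x S = 0 := by
  rw [mem_chowDeg_iff]
  exact ⟨fun h S hS hk => (coef_of_isBasic x hS).trans (h ⟨S, hS⟩ hk),
    fun h S hk => (coef_of_isBasic x S.2).symm.trans (h S.1 S.2 hk)⟩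

/-- Restriction to a product of induced subgraphs keeps the coefficients of the faces that it
contains. -/
theorem coef_chowPull {H : ∀ i, SimpleGraph (W i)} {G : ∀ i, SimpleGraph (V i)}
    {f : ∀ i, W i → V i} (hf : IsOrderedHom H G f) (hs : ∀ i, StrictMono (f i))
    (ha : ∀ i a b, (G i).Adj (f i a) (f i b) ↔ (H i).Adj a b) (x : Chow G)
    (S : Finset (∀ i, W i)) :
    coef H (chowPull hf x) S = coef G x (S.map (vmapEmb hs)) := by
  classical
  by_cases hS : IsBasic H S
  swap
  · rw [coef, coef, dif_neg hS, dif_neg fun h => hS ((isBasic_map hs ha).1 h)]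
  have hS' := (isBasic_map hs ha).2 hS
  rw [coef_of_isBasic _ hS, coef_of_isBasic _ hS']
  have key : ((chowBasis H).coord ⟨S, hS⟩).comp (chowPull hf).toAddMonoidHom.toIntLinearMap =
      (chowBasis G).coord ⟨S.map (vmapEmb hs), hS'⟩ := by
    refine (chowBasis G).ext fun T => ?_
    rw [LinearMap.comp_apply, Module.Basis.coord_apply, Module.Basis.coord_apply,
      Module.Basis.repr_self]
    have e : chowPull hf (chowBasis G T) = chowMk H (polyPull f (mon T.1.val)) := by
      rw [chowBasis_apply]
      rfl
    change (chowBasis H).repr (chowPull hf (chowBasis G T)) ⟨S, hS⟩ = _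
    rw [e]
    -- A basis monomial either comes from a basic face of `H` or contains a variable outside the
    -- image, which is sent to zero.
    by_cases hT : ∃ T' : Finset (∀ i, W i), T'.map (vmapEmb hs) = T.1
    · obtain ⟨T', hT'⟩ := hT
      have hb : IsBasic H T' := (isBasic_map hs ha).1 (hT' ▸ T.2)
      rw [← hT', Finset.map_val, polyPull_mon_map, ← chowBasis_apply H ⟨T', hb⟩,
        Module.Basis.repr_self, Finsupp.single_apply, Finsupp.single_apply]
      refine if_congr ?_ rfl rfl
      rw [Subtype.ext_iff, Subtype.ext_iff, ← hT', Finset.map_inj]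
    · have : ∃ v ∈ T.1, ∀ u, vmap f u ≠ v := by
        by_contra hc
        push Not at hc
        refine hT ⟨T.1.preimage (vmapEmb hs) (vmapEmb hs).injective.injOn, ?_⟩
        rw [Finset.map_eq_image, Finset.image_preimage]
        refine Finset.filter_true_of_mem fun v hv => ?_
        obtain ⟨u, hu⟩ := hc v hv
        exact ⟨u, hu⟩
      obtain ⟨v, hv, hu⟩ := this
      rw [polyPull_mon_eq_zero (Finset.mem_def.1 hv) hu, map_zero, map_zero, Finsupp.zero_apply,
        Finsupp.single_eq_of_ne]
      intro e
      exact hT ⟨S, congrArg Subtype.val e⟩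
  exact LinearMap.congr_fun key x

end Restriction

/-! ### Coefficients on subproducts, indexed by ambient faces -/

section Boxes

variable {d : ℕ} {V : Fin d → Type u} [∀ i, LinearOrder (V i)]

/-- All vertices in `S` belong to the product of the sets `T i`. -/
def InBox (T : ∀ i, Finset (V i)) (S : Finset (∀ i, V i)) : Prop :=
  ∀ v ∈ S, ∀ i, v i ∈ T i

/-- The inclusion of the vertices of a product of subgraphs. -/
def boxEmb (T : ∀ i, Finset (V i)) : (∀ i, T i) ↪ (∀ i, V i) :=
  vmapEmb (f := fun _ => Subtype.val) fun _ _ _ h => h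

theorem map_preimage_boxEmb {T : ∀ i, Finset (V i)} {S : Finset (∀ i, V i)} (h : InBox T S) :
    (S.preimage (boxEmb T) (boxEmb T).injective.injOn).map (boxEmb T) = S := by
  classical
  rw [Finset.map_eq_image, Finset.image_preimage]
  exact Finset.filter_true_of_mem fun v hv => ⟨fun i => ⟨v i, h v hv i⟩, rfl⟩

theorem inBox_map_boxEmb {T : ∀ i, Finset (V i)} (S : Finset (∀ i, T i)) :
    InBox T (S.map (boxEmb T)) := by
  intro v hv i
  obtain ⟨u, -, rfl⟩ := Finset.mem_map.1 hv
  exact (u i).2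

variable (G : ∀ i, SimpleGraph (V i))

theorem isBasic_preimage_boxEmb {T : ∀ i, Finset (V i)} {S : Finset (∀ i, V i)} (h : InBox T S) :
    IsBasic (sub G T) (S.preimage (boxEmb T) (boxEmb T).injective.injOn) ↔ IsBasic G S := by
  conv_rhs => rw [← map_preimage_boxEmb h]
  exact (isBasic_map (f := fun _ => Subtype.val) (fun _ _ _ h => h) fun _ _ _ => Iff.rfl).symm

/-- The coefficients of an element of the Chow ring of a product of induced subgraphs, indexed by
faces of the ambient product. -/
noncomputable def boxCoef (T : ∀ i, Finset (V i)) (x : Chow (sub G T)) (S : Finset (∀ i, V i)) :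
    ℤ :=
  coef (sub G T) x (S.preimage (boxEmb T) (boxEmb T).injective.injOn)

variable {G}

theorem eq_of_boxCoef_eq {T : ∀ i, Finset (V i)} {x y : Chow (sub G T)}
    (h : ∀ S, InBox T S → IsBasic G S → boxCoef G T x S = boxCoef G T y S) : x = y := by
  refine eq_of_coef_eq fun S hS => ?_
  have hS' : IsBasic G (S.map (boxEmb T)) :=
    (isBasic_map (f := fun _ => Subtype.val) (fun _ _ _ h => h) fun _ _ _ => Iff.rfl).2 hS
  have := h _ (inBox_map_boxEmb S) hS'
  simpa only [boxCoef, Finset.preimage_map] using this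

theorem boxCoef_restr [∀ i, Fintype (V i)] {T : ∀ i, Finset (V i)} (x : Chow G)
    {S : Finset (∀ i, V i)} (h : InBox T S) : boxCoef G T (restr G T x) S = coef G x S := by
  refine (coef_chowPull (f := fun _ => Subtype.val) _ (fun _ _ _ h => h) (fun _ _ _ => Iff.rfl) x
    _).trans ?_
  exact congrArg (coef G x) (map_preimage_boxEmb h)

theorem boxCoef_restrOfLE {T T' : ∀ i, Finset (V i)} (hT : ∀ i, T' i ⊆ T i) (x : Chow (sub G T))
    {S : Finset (∀ i, V i)} (h : InBox T' S) :
    boxCoef G T' (restrOfLE G hT x) S = boxCoef G T x S := by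
  have hs : ∀ i, StrictMono fun x : T' i => (⟨x.1, hT i x.2⟩ : T i) := fun _ _ _ h => h
  have hom : IsOrderedHom (sub G T') (sub G T) fun i x => ⟨x.1, hT i x.2⟩ :=
    ⟨fun i => (hs i).monotone, fun _ _ _ h => Or.inr h⟩
  have hadj : ∀ (i : Fin d) (a b : T' i),
      (sub G T i).Adj ⟨a.1, hT i a.2⟩ ⟨b.1, hT i b.2⟩ ↔ (sub G T' i).Adj a b :=
    fun _ _ _ => Iff.rfl
  have key := coef_chowPull hom hs hadj x (S.preimage (boxEmb T') (boxEmb T').injective.injOn)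
  refine key.trans (congrArg (coef (sub G T) x) ?_)
  apply Finset.map_injective (boxEmb T)
  rw [map_preimage_boxEmb fun v hv i => hT i (h v hv i), Finset.map_map]
  exact map_preimage_boxEmb h

theorem mem_chowDeg_iff_boxCoef {T : ∀ i, Finset (V i)} {k : ℕ} {x : Chow (sub G T)} :
    x ∈ chowDeg (sub G T) k ↔
      ∀ S, InBox T S → IsBasic G S → S.card ≠ k → boxCoef G T x S = 0 := by
  rw [mem_chowDeg_iff_coef]
  constructor
  · intro h S hST hS hk
    refine h _ ((isBasic_preimage_boxEmb G hST).2 hS) fun e => hk ?_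
    rw [← e, ← Finset.card_map (boxEmb T), map_preimage_boxEmb hST]
  · intro h S hS hk
    have hS' : IsBasic G (S.map (boxEmb T)) :=
      (isBasic_map (f := fun _ => Subtype.val) (fun _ _ _ h => h) fun _ _ _ => Iff.rfl).2 hS
    have := h _ (inBox_map_boxEmb S) hS' (by rwa [Finset.card_map])
    simpa only [boxCoef, Finset.preimage_map] using this

end Boxes

/-! ### Gluing coefficients over the hypercubes -/

section Localization

variable {d : ℕ} {V : Fin d → Type u} [∀ i, LinearOrder (V i)] {G : ∀ i, SimpleGraph (V i)}

theorem mem_edgeCube {e : ∀ i, (G i).edgeSet} {i : Fin d} {a : V i} :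
    a ∈ edgeCube e i ↔ a ∈ (e i : Sym2 (V i)) := Sym2.mem_toFinset

section Connected

variable [∀ i, Nontrivial (V i)]

theorem exists_mem_edge {U : Type u} [Nontrivial U] {H : SimpleGraph U} (hH : H.Connected) (a : U) :
    ∃ e : H.edgeSet, a ∈ (e : Sym2 U) := by
  obtain ⟨b, hb⟩ := hH.preconnected.exists_adj_of_nontrivial a
  exact ⟨⟨s(a, b), hb⟩, Sym2.mem_mk_left a b⟩

/-- Each face is contained in one of the hypercubes. -/
theorem IsFace.exists_inBox_edgeCube {S : Finset (∀ i, V i)} (hS : IsFace G S)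
    (hG : ∀ i, (G i).Connected) :
    ∃ e : ∀ i, (G i).edgeSet, InBox (edgeCube e) S := by
  have h : ∀ i, ∃ e : (G i).edgeSet, ∀ v ∈ S, v i ∈ (e : Sym2 (V i)) := by
    intro i
    by_cases hc : ∃ u ∈ S, ∃ v ∈ S, u i < v i
    · obtain ⟨u, hu, v, hv, huv⟩ := hc
      refine ⟨⟨s(u i, v i), (hS.adj u hu v hv i).resolve_left huv.ne⟩, fun w hw => ?_⟩
      rw [Sym2.mem_iff]
      by_cases e : w i = u i
      · exact Or.inl e
      · exact Or.inr (hS.eq_of_lt_of_ne hu hv hw huv e)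
    · rcases S.eq_empty_or_nonempty with rfl | ⟨v, hv⟩
      · obtain ⟨a⟩ := (inferInstance : Nonempty (V i))
        obtain ⟨e, -⟩ := exists_mem_edge (hG i) a
        exact ⟨e, by simp⟩
      · obtain ⟨e, he⟩ := exists_mem_edge (hG i) (v i)
        refine ⟨e, fun w hw => ?_⟩
        have : w i = v i := le_antisymm (not_lt.1 fun h => hc ⟨v, hv, w, hw, h⟩)
          (not_lt.1 fun h => hc ⟨w, hw, v, hv, h⟩)
        rwa [this]
  choose e he using h
  exact ⟨e, fun v hv i => mem_edgeCube.2 (he i v hv)⟩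

/-- Each cube is contained in one of the hypercubes. -/
theorem Cube.exists_subset_edgeCube (c : Cube G) (hG : ∀ i, (G i).Connected) :
    ∃ e : ∀ i, (G i).edgeSet, ∀ i, c.verts i ⊆ edgeCube e i := by
  have h : ∀ i, ∃ e : (G i).edgeSet, c.verts i ⊆ (e : Sym2 (V i)).toFinset := by
    intro i
    rcases c.isCube i with ⟨v, hv⟩ | ⟨e, he, hv⟩
    · obtain ⟨e, he⟩ := exists_mem_edge (hG i) v
      refine ⟨e, ?_⟩
      rw [hv, Finset.singleton_subset_iff]
      exact Sym2.mem_toFinset.2 he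
    · exact ⟨⟨e, he⟩, hv.le⟩
  choose e he using h
  exact ⟨e, he⟩

end Connected

/-- The hypercube of a family of edges, as a cube. -/
def Cube.ofEdges (e : ∀ i, (G i).edgeSet) : Cube G :=
  ⟨edgeCube e, fun i => Or.inr ⟨e i, (e i).2, rfl⟩⟩

/-- A shared facet, as a cube. -/
def SharedFacet.toCube {ordE : ∀ i, LinearOrder (G i).edgeSet} {i : Fin d}
    (x : SharedFacet G ordE i) : Cube G :=
  ⟨x.cube, fun j => by
    by_cases hj : j = i
    · subst hj
      left
      obtain ⟨hne, a, ha, ha'⟩ := x.adj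
      refine ⟨a, Finset.eq_singleton_iff_unique_mem.2
        ⟨Finset.mem_inter.2 ⟨mem_edgeCube.2 ha, mem_edgeCube.2 ha'⟩, fun b hb => ?_⟩⟩
      obtain ⟨hb, hb'⟩ := Finset.mem_inter.1 hb
      by_contra hba
      exact hne (Subtype.ext (Sym2.eq_of_ne_mem hba (mem_edgeCube.1 hb) ha
        (mem_edgeCube.1 hb') ha'))
    · right
      refine ⟨x.fst j, (x.fst j).2, ?_⟩
      have : x.cube j = edgeCube x.fst j ∩ edgeCube x.snd j := rfl
      rw [this, edgeCube, edgeCube, ← x.agree j hj, Finset.inter_self]⟩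

variable {ordE : ∀ i, LinearOrder (G i).edgeSet} {α : ∀ e : ∀ i, (G i).edgeSet, ChowCube G e}

/-- The coefficients of an element of the kernel of `facetDiff` agree on neighbouring hypercubes. -/
theorem boxCoef_eq_of_shared (hα : facetDiff G ordE α = 0) {S : Finset (∀ i, V i)} {i : Fin d}
    {e e' : ∀ i, (G i).edgeSet} (hee : ∀ j, j ≠ i → e j = e' j) {a : V i}
    (ha : a ∈ (e i : Sym2 (V i))) (ha' : a ∈ (e' i : Sym2 (V i))) (he : InBox (edgeCube e) S)
    (he' : InBox (edgeCube e') S) :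
    boxCoef G (edgeCube e) (α e) S = boxCoef G (edgeCube e') (α e') S := by
  have key : ∀ x : SharedFacet G ordE i, InBox (edgeCube x.fst) S → InBox (edgeCube x.snd) S →
      boxCoef G _ (α x.fst) S = boxCoef G _ (α x.snd) S := by
    intro x h h'
    have hx : InBox x.cube S := fun v hv j => Finset.mem_inter.2 ⟨h v hv j, h' v hv j⟩
    have := sub_eq_zero.1 (congrFun (congrFun hα i) x)
    rw [← boxCoef_restrOfLE x.cube_subset_fst _ hx, ← boxCoef_restrOfLE x.cube_subset_snd _ hx,
      this]
  by_cases h : e i = e' i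
  · have : e = e' := funext fun j => by
      by_cases hj : j = i
      · subst hj; exact h
      · exact hee j hj
    rw [this]
  · have hadj : (G i).lineGraph.Adj (e i) (e' i) := ⟨h, ⟨a, ha, ha'⟩⟩
    rcases @lt_or_gt_of_ne _ (ordE i) _ _ h with hlt | hlt
    · exact key ⟨e, e', hee, hadj, hlt⟩ he he'
    · exact (key ⟨e', e, fun j hj => (hee j hj).symm, hadj.symm, hlt⟩ he' he).symm

/-- The coefficients of an element of the kernel of `facetDiff` agree on hypercubes that differ in
one direction. -/
theorem boxCoef_eq_of_agree (hG : ∀ i, (G i).Connected) (hα : facetDiff G ordE α = 0)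
    {S : Finset (∀ i, V i)} {i : Fin d} {e e' : ∀ i, (G i).edgeSet}
    (hee : ∀ j, j ≠ i → e j = e' j) (he : InBox (edgeCube e) S) (he' : InBox (edgeCube e') S) :
    boxCoef G (edgeCube e) (α e) S = boxCoef G (edgeCube e') (α e') S := by
  -- A vertex `v` of `S` gives the common end `v i` of the two edges. The empty face gives none, so
  -- the edges are joined through a walk in the connected graph `G i`.
  rcases S.eq_empty_or_nonempty with rfl | ⟨v, hv⟩
  swap
  · exact boxCoef_eq_of_shared hα hee (mem_edgeCube.1 (he v hv i)) (mem_edgeCube.1 (he' v hv i))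
      he he'
  have key : ∀ (a b : V i) (_ : (G i).Walk a b) (f f' : ∀ i, (G i).edgeSet),
      (∀ j, j ≠ i → f j = f' j) → a ∈ (f i : Sym2 (V i)) → b ∈ (f' i : Sym2 (V i)) →
      boxCoef G (edgeCube f) (α f) ∅ = boxCoef G (edgeCube f') (α f') ∅ := by
    intro a b p
    induction p with
    | nil =>
      intro f f' hff hf hf'
      exact boxCoef_eq_of_shared hα hff hf hf' (by simp [InBox]) (by simp [InBox])
    | @cons a c b hac p ih =>
      intro f f' hff hf hf'
      set g : ∀ i, (G i).edgeSet := Function.update f i ⟨s(a, c), hac⟩ with hg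
      have hgi : g i = ⟨s(a, c), hac⟩ := Function.update_self ..
      have hgj : ∀ j, j ≠ i → g j = f j := fun j hj => Function.update_of_ne hj ..
      rw [boxCoef_eq_of_shared hα (fun j hj => (hgj j hj).symm) hf
        (by rw [hgi]; exact Sym2.mem_mk_left a c) (by simp [InBox]) (by simp [InBox])]
      exact ih g f' (fun j hj => (hgj j hj).trans (hff j hj))
        (by rw [hgi]; exact Sym2.mem_mk_right a c) hf'
  obtain ⟨p⟩ := (hG i).preconnected (e i : Sym2 (V i)).out.1 (e' i : Sym2 (V i)).out.1
  exact key _ _ p e e' hee (Sym2.out_fst_mem _) (Sym2.out_fst_mem _)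

/-- The coefficients of an element of the kernel of `facetDiff` do not depend on the hypercube. -/
theorem boxCoef_eq (hG : ∀ i, (G i).Connected) (hα : facetDiff G ordE α = 0)
    {S : Finset (∀ i, V i)} {e e' : ∀ i, (G i).edgeSet} (he : InBox (edgeCube e) S)
    (he' : InBox (edgeCube e') S) :
    boxCoef G (edgeCube e) (α e) S = boxCoef G (edgeCube e') (α e') S := by
  -- The edges are exchanged one index at a time. Intermediate hypercubes still contain `S`, as
  -- containment is a coordinatewise condition.
  have key : ∀ (J : Finset (Fin d)) (f : ∀ i, (G i).edgeSet), (∀ j, j ∉ J → e j = f j) →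
      InBox (edgeCube f) S →
      boxCoef G (edgeCube e) (α e) S = boxCoef G (edgeCube f) (α f) S := by
    intro J
    induction J using Finset.induction_on with
    | empty =>
      intro f hf _
      have : e = f := funext fun j => hf j (by simp)
      rw [this]
    | insert i J _ ih =>
      intro f hf hfS
      set g : ∀ i, (G i).edgeSet := Function.update f i (e i) with hg
      have hgi : g i = e i := Function.update_self ..
      have hgj : ∀ j, j ≠ i → g j = f j := fun j hj => Function.update_of_ne hj ..
      have hgS : InBox (edgeCube g) S := by
        intro v hv j
        rw [mem_edgeCube]
        by_cases hj : j = i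
        · subst hj
          rw [hgi]
          exact mem_edgeCube.1 (he v hv _)
        · rw [hgj j hj]
          exact mem_edgeCube.1 (hfS v hv j)
      rw [ih g (fun j hj => ?_) hgS]
      · exact boxCoef_eq_of_agree hG hα hgj hgS hfS
      · by_cases hji : j = i
        · subst hji
          exact hgi.symm
        · rw [hgj j hji]
          exact hf j (by simp [hji, hj])
  exact key Finset.univ e' (by simp) he'

variable [∀ i, Fintype (V i)]

theorem restrOfLE_restr {T T' : ∀ i, Finset (V i)} (hT : ∀ i, T' i ⊆ T i) (x : Chow G) :
    restrOfLE G hT (restr G T x) = restr G T' x := by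
  refine eq_of_boxCoef_eq fun S hS _ => ?_
  rw [boxCoef_restrOfLE hT _ hS, boxCoef_restr _ hS, boxCoef_restr]
  exact fun v hv i => hT i (hS v hv i)

theorem facetDiff_toHypercubes (ordE : ∀ i, LinearOrder (G i).edgeSet) (x : Chow G) :
    facetDiff G ordE (toHypercubes G x) = 0 := by
  funext i f
  refine sub_eq_zero.2 ?_
  exact (restrOfLE_restr f.cube_subset_fst x).trans (restrOfLE_restr f.cube_subset_snd x).symm

/-- The coefficient of `S` is read off in any hypercube containing it; by `boxCoef_eq` the choice is
immaterial. The default 0 is never compared with anything. -/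
theorem exists_toHypercubes_eq (hG : ∀ i, (G i).Connected) (hα : facetDiff G ordE α = 0) :
    ∃ x, toHypercubes G x = α := by
  classical
  obtain ⟨x, hx⟩ := exists_coef_eq G fun S =>
    if h : ∃ e : ∀ i, (G i).edgeSet, InBox (edgeCube e) S then
      boxCoef G (edgeCube h.choose) (α h.choose) S else 0
  refine ⟨x, funext fun e => eq_of_boxCoef_eq fun S he hS => ?_⟩
  have h : ∃ e : ∀ i, (G i).edgeSet, InBox (edgeCube e) S := ⟨e, he⟩
  refine (boxCoef_restr x he).trans ((hx S hS).trans ?_)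
  rw [dif_pos h]
  exact boxCoef_eq hG hα h.choose_spec he

variable [∀ i, Nontrivial (V i)]

theorem toHypercubes_injective (hG : ∀ i, (G i).Connected) :
    Function.Injective (toHypercubes G) := by
  intro x y h
  refine eq_of_coef_eq fun S hS => ?_
  obtain ⟨e, he⟩ := hS.isFace.exists_inBox_edgeCube hG
  rw [← boxCoef_restr x he, ← boxCoef_restr y he]
  exact congrArg (fun z => boxCoef G (edgeCube e) z S) (congrFun h e)

theorem mem_chowDeg_iff_toHypercubes (hG : ∀ i, (G i).Connected) (k : ℕ) (x : Chow G) :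
    x ∈ chowDeg G k ↔ ∀ e, toHypercubes G x e ∈ chowDeg (sub G (edgeCube e)) k := by
  rw [mem_chowDeg_iff_coef]
  constructor
  · intro h e
    exact mem_chowDeg_iff_boxCoef.2 fun S he hS hk => (boxCoef_restr x he).trans (h S hS hk)
  · intro h S hS hk
    obtain ⟨e, he⟩ := hS.isFace.exists_inBox_edgeCube hG
    exact (boxCoef_restr x he).symm.trans (mem_chowDeg_iff_boxCoef.1 (h e) S he hS hk)

theorem toCubes_injective (hG : ∀ i, (G i).Connected) : Function.Injective (toCubes G) := by
  intro x y h
  exact toHypercubes_injective hG (funext fun e => congrFun h (Cube.ofEdges e))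

/-- Shared facets are cubes, so a compatible family restricts to the kernel of `facetDiff` on
hypercubes and glues there. Its other components are forced, since each cube lies in a hypercube. -/
theorem range_toCubes (hG : ∀ i, (G i).Connected) (ordE : ∀ i, LinearOrder (G i).edgeSet) :
    (toCubes G).range = cubeLimit G := by
  ext y
  constructor
  · rintro ⟨x, rfl⟩ c c' h
    exact restrOfLE_restr h x
  · intro hy
    have hα : facetDiff G ordE (fun e => y (Cube.ofEdges e)) = 0 := by
      funext i f
      refine sub_eq_zero.2 ?_
      exact (hy f.toCube (Cube.ofEdges f.fst) f.cube_subset_fst).trans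
        (hy f.toCube (Cube.ofEdges f.snd) f.cube_subset_snd).symm
    obtain ⟨x, hx⟩ := exists_toHypercubes_eq hG hα
    refine ⟨x, funext fun c => ?_⟩
    obtain ⟨e, he⟩ := c.exists_subset_edgeCube hG
    rw [← hy c (Cube.ofEdges e) he, ← congrFun hx e]
    exact (restrOfLE_restr he x).symm

end Localization

end ChowGS

theorem mainTheorem2 {d : ℕ} (V : Fin d → Type u) [∀ i, Fintype (V i)] [∀ i, LinearOrder (V i)]
    [∀ i, Nontrivial (V i)] (G : ∀ i, SimpleGraph (V i)) (hG : ∀ i, (G i).Connected)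
    (ordE : ∀ i, LinearOrder (G i).edgeSet) :
    -- the product of the restrictions to the hypercubes is an injective map of graded rings
    Function.Injective (ChowGS.toHypercubes G) ∧
    (∀ (k : ℕ) (x : ChowGS.Chow G), x ∈ ChowGS.chowDeg G k ↔
      ∀ e : ∀ i, (G i).edgeSet,
        ChowGS.toHypercubes G x e ∈ ChowGS.chowDeg (ChowGS.sub G (ChowGS.edgeCube e)) k) ∧
    -- its image is the kernel of `j`
    (ChowGS.toHypercubes G).toAddMonoidHom.range = (ChowGS.facetDiff G ordE).ker ∧
    -- the Chow ring is the inverse limit of the Chow rings of the cubes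
    Function.Injective (ChowGS.toCubes G) ∧
    (ChowGS.toCubes G).range = ChowGS.cubeLimit G := by
  refine ⟨ChowGS.toHypercubes_injective hG, ChowGS.mem_chowDeg_iff_toHypercubes hG, ?_,
    ChowGS.toCubes_injective hG, ChowGS.range_toCubes hG ordE⟩
  ext α
  constructor
  · rintro ⟨x, rfl⟩
    exact ChowGS.facetDiff_toHypercubes ordE x
  · exact fun hα => ChowGS.exists_toHypercubes_eq hG hα
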